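/- Let $\alpha\in(0,1)$ be of the form $\alpha=\log t_0/\log N_0$ with $t_0,N_0\in\mathbb N$, $t_0\ge 1$, $N_0\geq 2$, and let $1\le p,q<\infty$ satisfy $$p<\frac{q(2-\alpha)}{\alpha(q-1)}$$ (for $q=1$ the right-hand side is read as $+\infty$). Then there are a probability measure $\mu$ on $[0,1]$ and functions $f_\ell$, $\ell=0,1,2,\dots$, of the following form such that $$\frac{\|\widehat{f_\ell\,d\mu}\|_{L^p(\mathbb R)}}{\|f_\ell\|_{L^q(d\mu)}}\longrightarrow\infty\qquad(\ell\to\infty),$$ where $\widehat{f\,d\mu}(\xi)=\int f(x)e^{-2\pi i x\xi}\,d\mu(x)$ (the $L^p$ norm may be $+\infty$). Construction: for some integer $n_0\ge1$ put $N=N_0^{2n_0}$, $t=t_0^{2n_0}$. There are finite sets $A_j$ with $A_0=\{0\}$, $A_{j+1}=\bigcup_{a\in A_j}(a+A_{j+1,a})$, where $A_{j+1,a}\subset N^{-(j+1)}\{0,\dots,N-1\}$ and $|A_{j+1,a}|=t$, and there is an arithmetic progression $P\subset\{0,\dots,N-1\}$ of length $t^{1/2}=t_0^{n_0}$ such that the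 sets $P_0=\{0\}$, $P_{j+1}=\bigcup_{a\in P_j}(a+N^{-(j+1)}P)$ satisfy $P_j\subset A_j$ for all $j$. The measure $\mu$ is the weak limit, as $j\to\infty$, of the measures with densities $\sum_{a\in A_j}t^{-j}N^j\mathbf 1_{[a,a+N^{-j}]}$, and $f_\ell=\mathbf 1_{F_\ell}$ with $F_\ell=\bigcup_{a\in P_\ell}[a,a+N^{-\ell})$. Moreover, $\mu$ and $E=\bigcap_j\bigcup_{a\in A_j}[a,a+N^{-j}]$ have the following properties: 1. $\mu$ is supported on $E$ (that is, $\mu(\mathbb R\setminus E)=0$), and $E$ has Hausdorff dimension $\alpha$; 2. there is $C_1$ with $\mu(B(y,r))\le C_1r^\alpha$ for all $y\in\mathbb R$, $r>0$; 3. for every $\beta<\alpha$ there is $C_2=C_2(\beta)$ with $|\widehat\mu(\xi)|\le C_2(1+|\xi|)^{-\beta/2}$ for all $\xi\in\mathbb R$. -/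

import Mathlib

open MeasureTheory Filter Topology
open scoped ENNReal BoundedContinuousFunction

noncomputable section

/-- Nodes of an `N`-adic tree with digit choices `D`: the integer `a ∈ cantorNodes N D j` encodes the
point `a / N ^ j`; the children of the node `a` of generation `j` are `N * a + d` with `d ∈ D j a`,
so that the corresponding points are `a / N ^ j + d / N ^ (j + 1)`. -/
def cantorNodes (N : ℕ) (D : ℕ → ℕ → Finset ℕ) : ℕ → Finset ℕ
  | 0 => {0}
  | j + 1 => (cantorNodes N D j).biUnion fun a => (D j a).image fun d => N * a + d

/-- Every node has exactly `t` admissible digits in `{0, …, N - 1}`. -/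
structure IsDigitChoice (N t : ℕ) (D : ℕ → ℕ → Finset ℕ) : Prop where
  subset_range : ∀ j a, D j a ⊆ Finset.range N
  card_eq : ∀ j a, (D j a).card = t

/-- The union of the closed intervals `[a / N ^ j, a / N ^ j + N ^ (-j)]` of generation `j`. -/
def cantorLevel (N : ℕ) (D : ℕ → ℕ → Finset ℕ) (j : ℕ) : Set ℝ :=
  ⋃ a ∈ cantorNodes N D j, Set.Icc ((a : ℝ) / (N : ℝ) ^ j) (((a : ℝ) + 1) / (N : ℝ) ^ j)

/-- The Cantor set determined by the digit choices `D`. -/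
def cantorLimitSet (N : ℕ) (D : ℕ → ℕ → Finset ℕ) : Set ℝ :=
  ⋂ j : ℕ, cantorLevel N D j

/-- The absolutely continuous measure with density
`∑_a t ^ (-j) N ^ j 1_{[a / N ^ j, a / N ^ j + N ^ (-j)]}`, `a` running over generation `j`. -/
def cantorApprox (N t : ℕ) (D : ℕ → ℕ → Finset ℕ) (j : ℕ) : Measure ℝ :=
  volume.withDensity fun x => ∑ a ∈ cantorNodes N D j,
    (Set.Icc ((a : ℝ) / (N : ℝ) ^ j) (((a : ℝ) + 1) / (N : ℝ) ^ j)).indicator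
      (fun _ => ENNReal.ofReal ((N : ℝ) ^ j / (t : ℝ) ^ j)) x

/-- Weak convergence of measures, tested against bounded continuous functions. -/
def IsWeakLimit (ν : ℕ → Measure ℝ) (μ : Measure ℝ) : Prop :=
  ∀ g : ℝ →ᵇ ℝ, Tendsto (fun j => ∫ x, g x ∂(ν j)) atTop (𝓝 (∫ x, g x ∂μ))

/-- The arithmetic progression `{x, x + d, …, x + (m - 1) d}`. -/
def arithProg (x d m : ℕ) : Finset ℕ :=
  (Finset.range m).image fun i => x + i * d

/-- The union of the half-open intervals `[a / N ^ l, a / N ^ l + N ^ (-l))` of generation `l` in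
the construction where every node has the same digit set `P`. -/
def structuredSet (N : ℕ) (P : Finset ℕ) (l : ℕ) : Set ℝ :=
  ⋃ a ∈ cantorNodes N (fun _ _ => P) l,
    Set.Ico ((a : ℝ) / (N : ℝ) ^ l) (((a : ℝ) + 1) / (N : ℝ) ^ l)

/-- The characteristic function of `structuredSet N P l`. -/
def structuredFun (N : ℕ) (P : Finset ℕ) (l : ℕ) : ℝ → ℂ :=
  (structuredSet N P l).indicator fun _ => 1

/-- The Fourier transform of `f dμ`, that is `ξ ↦ ∫ f(x) e^{-2πi x ξ} dμ(x)`. -/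
def fourierOf (μ : Measure ℝ) (f : ℝ → ℂ) (ξ : ℝ) : ℂ :=
  Fourier.fourierIntegral Real.fourierChar μ f ξ

end

/-! ### The tree of nodes and its uniform random branch -/

/-! Write `s = t₀ ^ n`, so that `t = s²`, `N ^ α = t` and `N ^ (α / 2) = s`. The set is a Cantor set
that looks random, so its Fourier transform decays almost optimally. It contains a much thinner
Cantor set with digits `{0, …, s - 1}`, whose arithmetic structure makes its sumsets small. The two
demands are compatible by counting. Generation `j` has `t ^ j` nodes, and independent digit sets
would give exponential sums of size about `t * s ^ j` by square-root cancellation. The structured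
tree has at most `s ^ j` nodes, so freezing their digits to `{0, …, t - 1}` and bounding their
contribution trivially costs only `2 * t * s ^ j`. The other digit sets are cyclic shifts of `{0, …,
t - 1}`, whose average is uniform. A derandomized Hoeffding bound (`exists_choice_sum_exp_le`) picks
the shifts for all frequencies of a fine grid at once, and `exists_levelDeviation_le_all` passes to
every frequency at the price of a factor `j + 1`. Telescoping over generations then gives decay with
any exponent below `α / 2` (`exists_fourierOf_cantorMeasure_le`). The measure is the image of
Lebesgue measure under a uniform random branch of the tree, which makes cell masses, weak
convergence and the mass distribution principle immediate. For the failure of restriction, let `ρ`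
be `μ` restricted to the structured set, of mass `M ≥ s ^ (-l)`, and let `r = ⌈p⌉`. The `r`-fold
convolution power of `ρ` lives on at most `(r * (s - 1) + 1) ^ l * (r + 1)` intervals of length `N ^
(-l)`, because sums of `r` digits fill a progression. By Cauchy–Schwarz the `2r`-th moment of the
transform of `ρ` is large on the scale `N ^ l`. Since this transform is bounded by `M` and `p ≤ 2r`,
its `p`-th moment is large too (`le_eLpNorm_integral_charExp`). The quotient therefore grows at
least like the `l`-th power of `(N / (r s)) ^ (1/p) * s ^ (-(1 - 1/q))`, and the condition on `p`
and `q` says exactly that a large `n` makes this base exceed `1`. -/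

/-- An enumeration of the nodes of generation `j` by `{0, …, t ^ j - 1}`. -/
noncomputable def nodeEnum (N t : ℕ) (D : ℕ → ℕ → Finset ℕ) : ℕ → ℕ → ℕ
  | 0, _ => 0
  | j + 1, m => N * nodeEnum N t D j (m / t) +
      Nat.nth (· ∈ D j (nodeEnum N t D j (m / t))) (m % t)

theorem mem_cantorNodes_succ {N : ℕ} {D : ℕ → ℕ → Finset ℕ} {j b : ℕ} :
    b ∈ cantorNodes N D (j + 1) ↔ ∃ a ∈ cantorNodes N D j, ∃ d ∈ D j a, N * a + d = b := by
  simp [cantorNodes]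

theorem cantorNodes_lt {N t : ℕ} {D : ℕ → ℕ → Finset ℕ} (hD : IsDigitChoice N t D) {j a : ℕ}
    (ha : a ∈ cantorNodes N D j) : a < N ^ j := by
  induction j generalizing a with
  | zero => simp [cantorNodes] at ha; simp [ha]
  | succ j ih =>
    obtain ⟨b, hb, d, hd, rfl⟩ := mem_cantorNodes_succ.1 ha
    have h1 := ih hb
    have h2 := Finset.mem_range.1 (hD.subset_range j b hd)
    calc N * b + d < N * b + N := by omega
      _ = N * (b + 1) := by ring
      _ ≤ N * N ^ j := Nat.mul_le_mul_left _ h1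
      _ = N ^ (j + 1) := by ring

theorem finset_toFinset_ofPred (s : Finset ℕ) (h : (Set.ofPred (· ∈ s)).Finite) :
    h.toFinset = s := by
  ext a; simp

theorem nth_mem_finset {s : Finset ℕ} {i : ℕ} (hi : i < s.card) : Nat.nth (· ∈ s) i ∈ s :=
  Nat.nth_mem_of_lt_card (p := (· ∈ s)) s.finite_toSet (by
    rw [finset_toFinset_ofPred]; exact hi)

theorem nth_finset_injOn {s : Finset ℕ} {i k : ℕ} (hi : i < s.card) (hk : k < s.card)
    (h : Nat.nth (· ∈ s) i = Nat.nth (· ∈ s) k) : i = k :=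
  Nat.nth_injOn (p := (· ∈ s)) s.finite_toSet
    (by rw [finset_toFinset_ofPred]; exact hi) (by rw [finset_toFinset_ofPred]; exact hk) h

theorem exists_nth_finset {s : Finset ℕ} {d : ℕ} (hd : d ∈ s) :
    ∃ i < s.card, Nat.nth (· ∈ s) i = d := by
  have h := Nat.image_nth_Iio_card (p := (· ∈ s)) s.finite_toSet
  rw [finset_toFinset_ofPred] at h
  have : d ∈ Nat.nth (· ∈ s) '' Set.Iio s.card := by rw [h]; exact hd
  obtain ⟨i, hi, h⟩ := this
  exact ⟨i, hi, h⟩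

theorem nodeEnum_mem {N t : ℕ} {D : ℕ → ℕ → Finset ℕ} (hD : IsDigitChoice N t D) (ht : 0 < t)
    (j m : ℕ) : nodeEnum N t D j m ∈ cantorNodes N D j := by
  induction j generalizing m with
  | zero => simp [nodeEnum, cantorNodes]
  | succ j ih =>
    refine mem_cantorNodes_succ.2 ⟨_, ih (m / t), _, nth_mem_finset ?_, rfl⟩
    rw [hD.card_eq]; exact Nat.mod_lt _ ht

/-- Every digit is below `N`, so integer division by `N` strips the last digit and leaves the
parent. Hence the nodes attached to one parameter form a branch. -/
theorem nodeEnum_succ_div {N t : ℕ} {D : ℕ → ℕ → Finset ℕ} (hD : IsDigitChoice N t D)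
    (ht : 0 < t) (j m : ℕ) : nodeEnum N t D (j + 1) m / N = nodeEnum N t D j (m / t) := by
  have h : Nat.nth (· ∈ D j (nodeEnum N t D j (m / t))) (m % t) < N :=
    Finset.mem_range.1 (hD.subset_range _ _ (nth_mem_finset (by
      rw [hD.card_eq]; exact Nat.mod_lt _ ht)))
  rw [nodeEnum, Nat.mul_add_div (by omega), Nat.div_eq_of_lt h, add_zero]

theorem nodeEnum_injOn {N t : ℕ} {D : ℕ → ℕ → Finset ℕ} (hD : IsDigitChoice N t D) (ht : 0 < t)
    {j m m' : ℕ} (hm : m < t ^ j) (hm' : m' < t ^ j)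
    (h : nodeEnum N t D j m = nodeEnum N t D j m') : m = m' := by
  induction j generalizing m m' with
  | zero => simp at hm hm'; omega
  | succ j ih =>
    have h1 : m / t = m' / t := by
      apply ih
      · exact Nat.div_lt_of_lt_mul (by rwa [pow_succ'] at hm)
      · exact Nat.div_lt_of_lt_mul (by rwa [pow_succ'] at hm')
      · rw [← nodeEnum_succ_div hD ht, ← nodeEnum_succ_div hD ht, h]
    rw [nodeEnum, nodeEnum, h1] at h
    have h2 : m % t = m' % t :=
      nth_finset_injOn (s := D j (nodeEnum N t D j (m' / t)))
        (by rw [hD.card_eq]; exact Nat.mod_lt _ ht)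
        (by rw [hD.card_eq]; exact Nat.mod_lt _ ht) (Nat.add_left_cancel h)
    rw [← Nat.div_add_mod m t, ← Nat.div_add_mod m' t, h1, h2]

theorem exists_nodeEnum_eq {N t : ℕ} {D : ℕ → ℕ → Finset ℕ} (hD : IsDigitChoice N t D)
    (ht : 0 < t) {j a : ℕ} (ha : a ∈ cantorNodes N D j) :
    ∃ m < t ^ j, nodeEnum N t D j m = a := by
  induction j generalizing a with
  | zero => simp [cantorNodes] at ha; exact ⟨0, by simp, by simp [nodeEnum, ha]⟩
  | succ j ih =>
    obtain ⟨b, hb, d, hd, rfl⟩ := mem_cantorNodes_succ.1 ha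
    obtain ⟨m, hm, rfl⟩ := ih hb
    obtain ⟨i, hi, rfl⟩ := exists_nth_finset hd
    rw [hD.card_eq] at hi
    refine ⟨t * m + i, ?_, ?_⟩
    · calc t * m + i < t * m + t := by omega
        _ = t * (m + 1) := by ring
        _ ≤ t * t ^ j := Nat.mul_le_mul_left _ hm
        _ = t ^ (j + 1) := by ring
    · have h1 : (t * m + i) / t = m := by
        rw [Nat.mul_add_div ht, Nat.div_eq_of_lt hi, add_zero]
      have h2 : (t * m + i) % t = i := by
        rw [Nat.mul_add_mod, Nat.mod_eq_of_lt hi]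
      rw [nodeEnum, h1, h2]

theorem card_cantorNodes {N t : ℕ} {D : ℕ → ℕ → Finset ℕ} (hD : IsDigitChoice N t D)
    (ht : 0 < t) (j : ℕ) : (cantorNodes N D j).card = t ^ j := by
  have : cantorNodes N D j = (Finset.range (t ^ j)).image (nodeEnum N t D j) := by
    ext a
    simp only [Finset.mem_image, Finset.mem_range]
    exact ⟨exists_nodeEnum_eq hD ht, fun ⟨m, _, h⟩ => h ▸ nodeEnum_mem hD ht j m⟩
  rw [this, Finset.card_image_of_injOn, Finset.card_range]
  intro m hm m' hm' h
  simp only [Finset.coe_range, Set.mem_Iio] at hm hm'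
  exact nodeEnum_injOn hD ht hm hm' h

/-- The node of generation `j` on the branch with parameter `u ∈ [0, 1)`. -/
noncomputable def branchNode (N t : ℕ) (D : ℕ → ℕ → Finset ℕ) (j : ℕ) (u : ℝ) : ℕ :=
  nodeEnum N t D j ⌊(t : ℝ) ^ j * u⌋₊

theorem measurable_branchNode (N t : ℕ) (D : ℕ → ℕ → Finset ℕ) (j : ℕ) :
    Measurable (branchNode N t D j) :=
  (measurable_of_countable (nodeEnum N t D j)).comp
    (Nat.measurable_floor.comp (measurable_const.mul measurable_id))

theorem branchNode_mem {N t : ℕ} {D : ℕ → ℕ → Finset ℕ} (hD : IsDigitChoice N t D)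
    (ht : 0 < t) (j : ℕ) (u : ℝ) : branchNode N t D j u ∈ cantorNodes N D j :=
  nodeEnum_mem hD ht _ _

theorem branchNode_succ_div {N t : ℕ} {D : ℕ → ℕ → Finset ℕ} (hD : IsDigitChoice N t D)
    (ht : 0 < t) (j : ℕ) (u : ℝ) :
    branchNode N t D (j + 1) u / N = branchNode N t D j u := by
  rw [branchNode, nodeEnum_succ_div hD ht, ← Nat.floor_div_natCast, branchNode]
  congr 2
  have : (t : ℝ) ≠ 0 := by positivity
  field_simp
  ring

/-- Lebesgue measure on `[0, 1)`. -/
noncomputable def unitMeasure : Measure ℝ := volume.restrict (Set.Ico 0 1)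

instance : IsProbabilityMeasure unitMeasure := ⟨by simp [unitMeasure]⟩

/-- By injectivity of the enumeration, the parameters leading to the node with index `m` form the
interval `[m / t ^ j, (m + 1) / t ^ j)`. -/
theorem unitMeasure_branchNode_eq {N t : ℕ} {D : ℕ → ℕ → Finset ℕ} (hD : IsDigitChoice N t D)
    (ht : 0 < t) {j a : ℕ} (ha : a ∈ cantorNodes N D j) :
    unitMeasure (branchNode N t D j ⁻¹' {a}) = ((t : ℝ≥0∞) ^ j)⁻¹ := by
  obtain ⟨m, hm, rfl⟩ := exists_nodeEnum_eq hD ht ha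
  have hp : (0 : ℝ) < (t : ℝ) ^ j := by positivity
  rw [unitMeasure, Measure.restrict_apply ((measurable_branchNode N t D j) (by simp))]
  have : branchNode N t D j ⁻¹' {nodeEnum N t D j m} ∩ Set.Ico 0 1
      = Set.Ico ((m : ℝ) / (t : ℝ) ^ j) ((m + 1 : ℝ) / (t : ℝ) ^ j) := by
    ext u
    simp only [Set.mem_inter_iff, Set.mem_preimage, Set.mem_singleton_iff, Set.mem_Ico,
      div_le_iff₀ hp, lt_div_iff₀ hp]
    constructor
    · rintro ⟨h, h0, h1⟩
      have hu : ⌊(t : ℝ) ^ j * u⌋₊ < t ^ j := by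
        rw [Nat.floor_lt (by positivity)]
        push_cast
        nlinarith
      have := nodeEnum_injOn hD ht hu hm h
      rw [Nat.floor_eq_iff (by positivity)] at this
      constructor <;> linarith [this.1, this.2, mul_comm u ((t : ℝ) ^ j)]
    · rintro ⟨h0, h1⟩
      have hu0 : 0 ≤ u := by
        by_contra h
        push Not at h
        have : (0 : ℝ) ≤ m := by positivity
        nlinarith
      have hm' : (m : ℝ) + 1 ≤ (t : ℝ) ^ j := by exact_mod_cast hm
      refine ⟨?_, hu0, ?_⟩
      · rw [branchNode, (Nat.floor_eq_iff (by positivity)).2 ⟨by linarith, by linarith⟩]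
      · by_contra h
        push Not at h
        nlinarith
  rw [this, Real.volume_Ico, ← sub_div, add_sub_cancel_left, one_div,
    ENNReal.ofReal_inv_of_pos hp, ENNReal.ofReal_pow (by positivity), ENNReal.ofReal_natCast]

theorem map_branchNode {N t : ℕ} {D : ℕ → ℕ → Finset ℕ} (hD : IsDigitChoice N t D)
    (ht : 0 < t) (j : ℕ) :
    unitMeasure.map (branchNode N t D j)
      = ∑ a ∈ cantorNodes N D j, ((t : ℝ≥0∞) ^ j)⁻¹ • Measure.dirac a := by
  refine Measure.ext_of_singleton fun a => ?_
  rw [Measure.map_apply (measurable_branchNode N t D j) (by simp)]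
  rw [Measure.finsetSum_apply]
  simp only [Measure.smul_apply, Measure.dirac_apply, smul_eq_mul]
  by_cases ha : a ∈ cantorNodes N D j
  · rw [unitMeasure_branchNode_eq hD ht ha, Finset.sum_eq_single_of_mem a ha]
    · simp
    · intro b _ hb
      simp [hb]
  · rw [Finset.sum_eq_zero]
    · have : branchNode N t D j ⁻¹' {a} = ∅ := by
        ext u
        simp only [Set.mem_preimage, Set.mem_singleton_iff, Set.mem_empty_iff_false, iff_false]
        rintro rfl
        exact ha (branchNode_mem hD ht j u)
      simp [this]
    · intro b hb
      have : b ≠ a := by rintro rfl; exact ha hb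
      simp [this]

theorem unitMeasure_branchNode_mem {N t : ℕ} {D : ℕ → ℕ → Finset ℕ} (hD : IsDigitChoice N t D)
    (ht : 0 < t) {j : ℕ} {S : Finset ℕ} (hS : S ⊆ cantorNodes N D j) :
    unitMeasure (branchNode N t D j ⁻¹' S) = S.card * ((t : ℝ≥0∞) ^ j)⁻¹ := by
  rw [← Measure.map_apply (measurable_branchNode N t D j) (by simp), map_branchNode hD ht,
    Measure.finsetSum_apply]
  simp only [Measure.smul_apply, Measure.dirac_apply, smul_eq_mul]
  rw [← Finset.sum_subset hS]
  · rw [Finset.sum_congr rfl (g := fun _ => ((t : ℝ≥0∞) ^ j)⁻¹)]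
    · simp
    · intro a ha; simp [ha]
  · intro a _ ha
    simp [ha]

theorem integral_branchNode {N t : ℕ} {D : ℕ → ℕ → Finset ℕ} (hD : IsDigitChoice N t D)
    (ht : 0 < t) {E : Type*} [NormedAddCommGroup E] [NormedSpace ℝ E] [CompleteSpace E]
    (j : ℕ) (h : ℕ → E) :
    ∫ u, h (branchNode N t D j u) ∂unitMeasure
      = ((t : ℝ) ^ j)⁻¹ • ∑ a ∈ cantorNodes N D j, h a := by
  rw [← integral_map (measurable_branchNode N t D j).aemeasurable (f := h)
    StronglyMeasurable.of_discrete.aestronglyMeasurable, map_branchNode hD ht,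
    integral_finsetSum_measure, Finset.smul_sum]
  · refine Finset.sum_congr rfl fun a _ => ?_
    rw [integral_smul_measure, integral_dirac]
    simp
  · intro a _
    refine Integrable.smul_measure ?_ ?_
    · exact integrable_dirac (by simp)
    · simp [ht.ne']

/-! ### The natural measure on the Cantor set -/

/-- The point of the Cantor set on the branch with parameter `u`. -/
noncomputable def branchPoint (N t : ℕ) (D : ℕ → ℕ → Finset ℕ) (u : ℝ) : ℝ :=
  ⨆ j : ℕ, (branchNode N t D j u : ℝ) / (N : ℝ) ^ j

/-- The natural measure on the Cantor set. -/
noncomputable def cantorMeasure (N t : ℕ) (D : ℕ → ℕ → Finset ℕ) : Measure ℝ :=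
  unitMeasure.map (branchPoint N t D)

theorem measurable_branchPoint (N t : ℕ) (D : ℕ → ℕ → Finset ℕ) :
    Measurable (branchPoint N t D) :=
  Measurable.iSup fun j =>
    (measurable_from_nat.comp (measurable_branchNode N t D j)).div_const _

instance (N t : ℕ) (D : ℕ → ℕ → Finset ℕ) : IsProbabilityMeasure (cantorMeasure N t D) :=
  Measure.isProbabilityMeasure_map (measurable_branchPoint N t D).aemeasurable

theorem branchNode_div_mono {N t : ℕ} {D : ℕ → ℕ → Finset ℕ} (hD : IsDigitChoice N t D)
    (ht : 0 < t) (hN : 0 < N) (u : ℝ) :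
    Monotone fun j : ℕ => (branchNode N t D j u : ℝ) / (N : ℝ) ^ j := by
  refine monotone_nat_of_le_succ fun j => ?_
  have h := Nat.div_mul_le_self (branchNode N t D (j + 1) u) N
  rw [branchNode_succ_div hD ht] at h
  have h' : (branchNode N t D j u : ℝ) * N ≤ branchNode N t D (j + 1) u := by exact_mod_cast h
  have hN' : (0 : ℝ) < N := by exact_mod_cast hN
  rw [div_le_div_iff₀ (by positivity) (by positivity), pow_succ']
  nlinarith [pow_pos hN' j]

theorem branchNode_succ_div_anti {N t : ℕ} {D : ℕ → ℕ → Finset ℕ} (hD : IsDigitChoice N t D)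
    (ht : 0 < t) (hN : 0 < N) (u : ℝ) :
    Antitone fun j : ℕ => ((branchNode N t D j u : ℝ) + 1) / (N : ℝ) ^ j := by
  refine antitone_nat_of_succ_le fun j => ?_
  have h := Nat.lt_div_mul_add hN (a := branchNode N t D (j + 1) u)
  rw [branchNode_succ_div hD ht] at h
  have h' : (branchNode N t D (j + 1) u : ℝ) + 1 ≤ (branchNode N t D j u : ℝ) * N + N := by
    exact_mod_cast h
  have hN' : (0 : ℝ) < N := by exact_mod_cast hN
  rw [div_le_div_iff₀ (by positivity) (by positivity), pow_succ']
  nlinarith [pow_pos hN' j]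

theorem branchNode_div_le {N t : ℕ} {D : ℕ → ℕ → Finset ℕ} (hD : IsDigitChoice N t D)
    (ht : 0 < t) (hN : 0 < N) (j k : ℕ) (u : ℝ) :
    (branchNode N t D k u : ℝ) / (N : ℝ) ^ k ≤ ((branchNode N t D j u : ℝ) + 1) / (N : ℝ) ^ j := by
  have h1 := branchNode_div_mono hD ht hN u (le_max_left k j)
  have h2 := branchNode_succ_div_anti hD ht hN u (le_max_right k j)
  refine h1.trans (le_trans ?_ h2)
  have hN' : (0 : ℝ) < N := by exact_mod_cast hN
  exact div_le_div_of_nonneg_right (by linarith) (by positivity)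

theorem bddAbove_branchNode_div {N t : ℕ} {D : ℕ → ℕ → Finset ℕ} (hD : IsDigitChoice N t D)
    (ht : 0 < t) (hN : 0 < N) (u : ℝ) :
    BddAbove (Set.range fun j : ℕ => (branchNode N t D j u : ℝ) / (N : ℝ) ^ j) := by
  refine ⟨((branchNode N t D 0 u : ℝ) + 1) / (N : ℝ) ^ 0, ?_⟩
  rintro _ ⟨k, rfl⟩
  exact branchNode_div_le hD ht hN 0 k u

/-- Along a branch the left endpoints increase and the right endpoints decrease. The limit can be a
right endpoint, so only closed cells work here. -/
theorem branchPoint_mem_Icc {N t : ℕ} {D : ℕ → ℕ → Finset ℕ} (hD : IsDigitChoice N t D)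
    (ht : 0 < t) (hN : 0 < N) (j : ℕ) (u : ℝ) :
    branchPoint N t D u ∈ Set.Icc ((branchNode N t D j u : ℝ) / (N : ℝ) ^ j)
      (((branchNode N t D j u : ℝ) + 1) / (N : ℝ) ^ j) :=
  ⟨le_ciSup (bddAbove_branchNode_div hD ht hN u) j,
    ciSup_le fun k => branchNode_div_le hD ht hN j k u⟩

theorem tendsto_branchNode_div {N t : ℕ} {D : ℕ → ℕ → Finset ℕ} (hD : IsDigitChoice N t D)
    (ht : 0 < t) (hN : 0 < N) (u : ℝ) :
    Tendsto (fun j : ℕ => (branchNode N t D j u : ℝ) / (N : ℝ) ^ j) atTop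
      (𝓝 (branchPoint N t D u)) :=
  tendsto_atTop_ciSup (branchNode_div_mono hD ht hN u) (bddAbove_branchNode_div hD ht hN u)

theorem isClosed_cantorLevel (N : ℕ) (D : ℕ → ℕ → Finset ℕ) (j : ℕ) :
    IsClosed (cantorLevel N D j) :=
  isClosed_biUnion_finset fun _ _ => isClosed_Icc

theorem isClosed_cantorLimitSet (N : ℕ) (D : ℕ → ℕ → Finset ℕ) :
    IsClosed (cantorLimitSet N D) :=
  isClosed_iInter fun j => isClosed_cantorLevel N D j

theorem branchPoint_mem_cantorLimitSet {N t : ℕ} {D : ℕ → ℕ → Finset ℕ}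
    (hD : IsDigitChoice N t D) (ht : 0 < t) (hN : 0 < N) (u : ℝ) :
    branchPoint N t D u ∈ cantorLimitSet N D :=
  Set.mem_iInter.2 fun j => Set.mem_iUnion₂.2
    ⟨_, branchNode_mem hD ht j u, branchPoint_mem_Icc hD ht hN j u⟩

theorem cantorMeasure_compl_cantorLimitSet {N t : ℕ} {D : ℕ → ℕ → Finset ℕ}
    (hD : IsDigitChoice N t D) (ht : 0 < t) (hN : 0 < N) :
    cantorMeasure N t D (cantorLimitSet N D)ᶜ = 0 := by
  rw [cantorMeasure, Measure.map_apply (measurable_branchPoint N t D)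
    (isClosed_cantorLimitSet N D).measurableSet.compl]
  convert measure_empty (μ := unitMeasure)
  ext u
  simp [branchPoint_mem_cantorLimitSet hD ht hN u]

theorem cantorLimitSet_subset_Icc (N : ℕ) (D : ℕ → ℕ → Finset ℕ) :
    cantorLimitSet N D ⊆ Set.Icc 0 1 := by
  intro x hx
  simpa [cantorLevel, cantorNodes] using Set.mem_iInter.1 hx 0

/-! ### Masses of balls, absence of atoms, and the mass of the structured set -/

/-- An interval of length `L / N ^ j` meets at most `L + 1` left endpoints of generation `j`. -/
theorem unitMeasure_branchNode_Icc_le {N t : ℕ} {D : ℕ → ℕ → Finset ℕ}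
    (hD : IsDigitChoice N t D) (ht : 0 < t) (j : ℕ) (c : ℝ) (L : ℕ) :
    unitMeasure {u | (branchNode N t D j u : ℝ) ∈ Set.Icc c (c + L)}
      ≤ (L + 1 : ℕ) * ((t : ℝ≥0∞) ^ j)⁻¹ := by
  classical
  set S := (cantorNodes N D j).filter fun a : ℕ => (a : ℝ) ∈ Set.Icc c (c + L) with hS
  have h1 : {u | (branchNode N t D j u : ℝ) ∈ Set.Icc c (c + L)}
      = branchNode N t D j ⁻¹' S := by
    ext u
    simp [hS, branchNode_mem hD ht j u]
  have h2 : S.card ≤ L + 1 := by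
    have : S ⊆ Finset.Icc ⌈c⌉₊ (⌈c⌉₊ + L) := by
      intro a ha
      have ha' := (Finset.mem_filter.1 ha).2
      refine Finset.mem_Icc.2 ⟨Nat.ceil_le.2 ha'.1, ?_⟩
      have h3 : (a : ℝ) ≤ ((⌈c⌉₊ + L : ℕ) : ℝ) := by
        push_cast
        linarith [ha'.2, Nat.le_ceil c]
      exact_mod_cast h3
    calc S.card ≤ _ := Finset.card_le_card this
      _ = L + 1 := by rw [Nat.card_Icc]; omega
  rw [h1, unitMeasure_branchNode_mem hD ht (Finset.filter_subset _ _)]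
  gcongr

theorem cantorMeasure_closedBall_le {N t : ℕ} {D : ℕ → ℕ → Finset ℕ}
    (hD : IsDigitChoice N t D) (ht : 0 < t) (hN : 0 < N) (j : ℕ) {r : ℝ} (y : ℝ)
    (hr : r ≤ 1 / (N : ℝ) ^ j) :
    cantorMeasure N t D (Metric.closedBall y r) ≤ 4 * ((t : ℝ≥0∞) ^ j)⁻¹ := by
  have hN' : (0 : ℝ) < (N : ℝ) ^ j := by positivity
  rw [cantorMeasure, Measure.map_apply (measurable_branchPoint N t D)
    Metric.isClosed_closedBall.measurableSet]
  -- If the cell of `a` meets the ball, then `(y - r) N ^ j - 1 ≤ a ≤ (y + r) N ^ j`; as `r N ^ j ≤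
  -- 1`, this window has length at most `3` and holds at most four nodes.
  refine (measure_mono ?_).trans
    (unitMeasure_branchNode_Icc_le hD ht j ((y - r) * (N : ℝ) ^ j - 1) 3)
  intro u hu
  rw [Set.mem_preimage, Real.closedBall_eq_Icc] at hu
  obtain ⟨h1, h2⟩ := branchPoint_mem_Icc hD ht hN j u
  rw [div_le_iff₀ hN'] at h1
  rw [le_div_iff₀ hN'] at h2
  rw [le_div_iff₀ hN'] at hr
  have h3 := mul_le_mul_of_nonneg_right hu.1 hN'.le
  have h4 := mul_le_mul_of_nonneg_right hu.2 hN'.le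
  constructor
  · linarith
  · push_cast
    linarith

/-- For `N ^ (-(j + 1)) < r ≤ N ^ (-j)` the mass is at most `4 t ^ (-j) = 4 t * N ^ (-(j + 1) α)`;
the factor `t` pays for the gap between consecutive scales. Radii `r ≥ 1` are covered by total mass
one. -/
theorem cantorMeasure_closedBall_le_rpow {N t : ℕ} {D : ℕ → ℕ → Finset ℕ} {α : ℝ}
    (hD : IsDigitChoice N t D) (ht : 0 < t) (hN : 1 < N) (hα : 0 ≤ α)
    (hNt : (N : ℝ) ^ α = t) (y r : ℝ) (hr : 0 < r) :
    cantorMeasure N t D (Metric.closedBall y r) ≤ ENNReal.ofReal (4 * t * r ^ α) := by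
  have hN' : (1 : ℝ) < N := by exact_mod_cast hN
  have ht' : (1 : ℝ) ≤ t := by exact_mod_cast ht
  by_cases h1 : 1 ≤ r
  · refine prob_le_one.trans ?_
    rw [ENNReal.one_le_ofReal]
    have := Real.one_le_rpow h1 hα
    nlinarith
  push Not at h1
  obtain ⟨j, hj1, hj2⟩ := exists_nat_pow_near_of_lt_one hr h1.le
    (inv_pos.2 (by linarith : (0 : ℝ) < N)) (inv_lt_one_of_one_lt₀ hN')
  refine (cantorMeasure_closedBall_le hD ht (by omega) j y
    (by rw [one_div, ← inv_pow]; exact hj2)).trans ?_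
  have h2 : ((t : ℝ) ^ (j + 1))⁻¹ ≤ r ^ α := by
    have := Real.rpow_le_rpow (by positivity) hj1.le hα
    rw [inv_pow, Real.inv_rpow (by positivity), ← Real.rpow_natCast, ← Real.rpow_mul (by positivity),
      mul_comm, Real.rpow_mul (by positivity), hNt, Real.rpow_natCast] at this
    exact this
  have h3 : 4 * ((t : ℝ≥0∞) ^ j)⁻¹ = ENNReal.ofReal (4 * ((t : ℝ) ^ j)⁻¹) := by
    rw [ENNReal.ofReal_mul (by norm_num), ENNReal.ofReal_inv_of_pos (by positivity),
      ENNReal.ofReal_pow (by positivity), ENNReal.ofReal_natCast]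
    norm_num
  rw [h3]
  refine ENNReal.ofReal_le_ofReal ?_
  calc 4 * ((t : ℝ) ^ j)⁻¹ = 4 * t * ((t : ℝ) ^ (j + 1))⁻¹ := by
        rw [pow_succ]; field_simp
    _ ≤ _ := by gcongr

/-- The ball of radius zero is admissible at every generation, so a point has mass at most `4 t ^
(-j)` for all `j`. This lets half-open cells replace closed ones. -/
theorem cantorMeasure_nullSingletonClass {N t : ℕ} {D : ℕ → ℕ → Finset ℕ}
    (hD : IsDigitChoice N t D) (ht : 1 < t) (hN : 0 < N) :
    NullSingletonClass (cantorMeasure N t D) := by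
  refine ⟨fun y => ?_⟩
  have h : ∀ j : ℕ, cantorMeasure N t D {y} ≤ 4 * ((t : ℝ≥0∞)⁻¹) ^ j := fun j => by
    have := cantorMeasure_closedBall_le hD (by omega) hN j (r := 0) y (by positivity)
    rwa [Metric.closedBall_zero, ENNReal.inv_pow] at this
  have h2 : Tendsto (fun j : ℕ => 4 * ((t : ℝ≥0∞)⁻¹) ^ j) atTop (𝓝 (4 * 0)) := by
    refine ENNReal.Tendsto.const_mul (ENNReal.tendsto_pow_atTop_nhds_zero_of_lt_one ?_)
      (Or.inr (by norm_num))
    rw [ENNReal.inv_lt_one]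
    exact_mod_cast ht
  rw [mul_zero] at h2
  exact le_antisymm (ge_of_tendsto' h2 h) zero_le

theorem measurableSet_structuredSet (N : ℕ) (P : Finset ℕ) (l : ℕ) :
    MeasurableSet (structuredSet N P l) :=
  Finset.measurableSet_biUnion _ fun _ _ => measurableSet_Ico

theorem le_cantorMeasure_structuredSet {N t : ℕ} {D : ℕ → ℕ → Finset ℕ}
    (hD : IsDigitChoice N t D) (ht : 1 < t) (hN : 0 < N) (P : Finset ℕ) (l : ℕ)
    (hP : cantorNodes N (fun _ _ => P) l ⊆ cantorNodes N D l) :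
    (cantorNodes N (fun _ _ => P) l).card * ((t : ℝ≥0∞) ^ l)⁻¹
      ≤ cantorMeasure N t D (structuredSet N P l) := by
  have := cantorMeasure_nullSingletonClass hD ht hN
  set S := cantorNodes N (fun _ _ => P) l with hS
  rw [← unitMeasure_branchNode_mem hD (by omega) hP]
  have hR : cantorMeasure N t D (⋃ a ∈ S, {((a : ℝ) + 1) / (N : ℝ) ^ l}) = 0 := by
    exact (measure_biUnion_null_iff S.countable_toSet).2 fun a _ => measure_singleton _
  calc unitMeasure (branchNode N t D l ⁻¹' S)
      ≤ unitMeasure (branchPoint N t D ⁻¹'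
        (structuredSet N P l ∪ ⋃ a ∈ S, {((a : ℝ) + 1) / (N : ℝ) ^ l})) := by
        refine measure_mono fun u hu => ?_
        have hu' : branchNode N t D l u ∈ S := hu
        obtain ⟨h1, h2⟩ := branchPoint_mem_Icc hD (by omega) hN l u
        rcases h2.lt_or_eq with h2 | h2
        · exact Or.inl (Set.mem_iUnion₂.2 ⟨_, hu', h1, h2⟩)
        · exact Or.inr (Set.mem_iUnion₂.2 ⟨_, hu', h2⟩)
    _ = cantorMeasure N t D (structuredSet N P l ∪ ⋃ a ∈ S, {((a : ℝ) + 1) / (N : ℝ) ^ l}) := by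
        rw [cantorMeasure, Measure.map_apply (measurable_branchPoint N t D)]
        exact (measurableSet_structuredSet N P l).union
          (Finset.measurableSet_biUnion _ fun _ _ => measurableSet_singleton _)
    _ ≤ _ := by
        refine (measure_union_le _ _).trans ?_
        rw [hR, add_zero]

/-! ### Convergence of the approximating measures -/

/-- The average of `g` over the interval `[a / N ^ j, (a + 1) / N ^ j]`. -/
noncomputable def cellAverage {E : Type*} [NormedAddCommGroup E] [NormedSpace ℝ E] (N : ℕ)
    (g : ℝ → E) (j a : ℕ) : E :=
  ∫ v in (0 : ℝ)..1, g (((a : ℝ) + v) / (N : ℝ) ^ j)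

theorem integral_cantorApprox {N t : ℕ} (D : ℕ → ℕ → Finset ℕ) (ht : 0 < t)
    (hN : 0 < N) (j : ℕ) (g : ℝ →ᵇ ℝ) :
    ∫ x, g x ∂(cantorApprox N t D j)
      = ((t : ℝ) ^ j)⁻¹ • ∑ a ∈ cantorNodes N D j, cellAverage N g j a := by
  have hN' : (0 : ℝ) < (N : ℝ) ^ j := by positivity
  rw [cantorApprox, integral_withDensity_eq_integral_toReal_smul]
  · have h1 : ∀ x : ℝ, (∑ a ∈ cantorNodes N D j,
        (Set.Icc ((a : ℝ) / (N : ℝ) ^ j) (((a : ℝ) + 1) / (N : ℝ) ^ j)).indicator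
        (fun _ => ENNReal.ofReal ((N : ℝ) ^ j / (t : ℝ) ^ j)) x).toReal • g x
        = ∑ a ∈ cantorNodes N D j,
        (Set.Icc ((a : ℝ) / (N : ℝ) ^ j) (((a : ℝ) + 1) / (N : ℝ) ^ j)).indicator
        (fun x => ((N : ℝ) ^ j / (t : ℝ) ^ j) * g x) x := by
      intro x
      rw [ENNReal.toReal_sum, Finset.sum_smul]
      · refine Finset.sum_congr rfl fun a _ => ?_
        by_cases hx : x ∈ Set.Icc ((a : ℝ) / (N : ℝ) ^ j) (((a : ℝ) + 1) / (N : ℝ) ^ j)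
        · rw [Set.indicator_of_mem hx, Set.indicator_of_mem hx,
            ENNReal.toReal_ofReal (by positivity), smul_eq_mul]
        · rw [Set.indicator_of_notMem hx, Set.indicator_of_notMem hx]
          simp
      · intro a _
        refine ne_of_lt (lt_of_le_of_lt (Set.indicator_le_self' (by simp) x) ENNReal.ofReal_lt_top)
    simp_rw [h1]
    rw [integral_finsetSum, Finset.smul_sum]
    · refine Finset.sum_congr rfl fun a _ => ?_
      have hle : (a : ℝ) / (N : ℝ) ^ j ≤ ((a : ℝ) + 1) / (N : ℝ) ^ j := by gcongr; linarith
      rw [integral_indicator measurableSet_Icc, integral_Icc_eq_integral_Ioc,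
        ← intervalIntegral.integral_of_le hle, intervalIntegral.integral_const_mul, cellAverage]
      have h2 : ∀ v : ℝ, ((a : ℝ) + v) / (N : ℝ) ^ j = (a : ℝ) / (N : ℝ) ^ j + v / (N : ℝ) ^ j :=
        fun v => add_div _ _ _
      simp_rw [h2]
      rw [intervalIntegral.integral_comp_add_div g hN'.ne']
      simp only [smul_eq_mul, zero_div, add_zero]
      field_simp
    · intro a _
      refine IntegrableOn.integrable_indicator ?_ measurableSet_Icc
      exact (Continuous.continuousOn (by fun_prop)).integrableOn_Icc
  · refine Finset.measurable_sum _ fun a _ => ?_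
    exact measurable_const.indicator measurableSet_Icc
  · refine ae_of_all _ fun x => ENNReal.sum_lt_top.2 fun a _ => ?_
    exact lt_of_le_of_lt (Set.indicator_le_self' (by simp) x) ENNReal.ofReal_lt_top

/-- The sum is the expectation, over the random branch, of the average of `g` over the current cell.
These averages converge to `g` at the branch point, boundedly. Vector values allow the use for real
test functions and for characters alike. -/
theorem tendsto_sum_cellAverage {N t : ℕ} {D : ℕ → ℕ → Finset ℕ} (hD : IsDigitChoice N t D)
    (ht : 0 < t) (hN : 1 < N) {E : Type*} [NormedAddCommGroup E] [NormedSpace ℝ E]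
    [CompleteSpace E] [SecondCountableTopology E] [MeasurableSpace E] [BorelSpace E]
    {g : ℝ → E} (hg : Continuous g) {C : ℝ} (hC : ∀ x, ‖g x‖ ≤ C) :
    Tendsto (fun j : ℕ => ((t : ℝ) ^ j)⁻¹ • ∑ a ∈ cantorNodes N D j, cellAverage N g j a) atTop
      (𝓝 (∫ x, g x ∂cantorMeasure N t D)) := by
  have hbd : ∀ j a, ‖cellAverage N g j a‖ ≤ C := fun j a => by
    simpa [cellAverage] using intervalIntegral.norm_integral_le_of_norm_le_const (a := (0 : ℝ)) (b := 1)
      (f := fun v => g (((a : ℝ) + v) / (N : ℝ) ^ j)) (C := C) (fun v _ => hC _)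
  rw [cantorMeasure, integral_map (measurable_branchPoint N t D).aemeasurable
    hg.aestronglyMeasurable]
  simp_rw [← integral_branchNode hD ht _ (cellAverage N g _)]
  refine tendsto_integral_of_dominated_convergence (fun _ => C) ?_ (integrable_const _) ?_ ?_
  · intro j
    exact ((measurable_from_nat (f := cellAverage N g j)).comp
      (measurable_branchNode N t D j)).aestronglyMeasurable
  · exact fun j => ae_of_all _ fun u => hbd j _
  · refine ae_of_all _ fun u => ?_
    have hlim : ∀ v : ℝ, Tendsto (fun j : ℕ => g (((branchNode N t D j u : ℝ) + v) / (N : ℝ) ^ j))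
        atTop (𝓝 (g (branchPoint N t D u))) := by
      intro v
      refine (hg.tendsto _).comp ?_
      have h1 := tendsto_branchNode_div hD ht (by omega) u
      have h2 : Tendsto (fun j : ℕ => v / (N : ℝ) ^ j) atTop (𝓝 0) :=
        tendsto_const_nhds.div_atTop
          (tendsto_pow_atTop_atTop_of_one_lt (by exact_mod_cast hN))
      simpa [add_div] using h1.add h2
    have := intervalIntegral.tendsto_integral_filter_of_dominated_convergence
      (μ := volume) (a := (0 : ℝ)) (b := 1) (l := (atTop : Filter ℕ))
      (F := fun (j : ℕ) v => g (((branchNode N t D j u : ℝ) + v) / (N : ℝ) ^ j))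
      (f := fun _ => g (branchPoint N t D u)) (fun _ => C)
      (Eventually.of_forall fun j => (hg.comp (by fun_prop)).aestronglyMeasurable)
      (Eventually.of_forall fun j => ae_of_all _ fun v _ => hC _)
      intervalIntegrable_const (ae_of_all _ fun v _ => hlim v)
    simpa [cellAverage] using this

theorem isWeakLimit_cantorMeasure {N t : ℕ} {D : ℕ → ℕ → Finset ℕ} (hD : IsDigitChoice N t D)
    (ht : 0 < t) (hN : 1 < N) : IsWeakLimit (cantorApprox N t D) (cantorMeasure N t D) := by
  intro g
  simp_rw [integral_cantorApprox D ht (by omega : 0 < N)]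
  exact tendsto_sum_cellAverage hD ht hN g.continuous (C := ‖g‖) g.norm_coe_le_norm

/-! ### The Hausdorff dimension of the Cantor set -/

/-- Upper bound: the `t ^ j` cells of diameter `N ^ (-j)` have `α`-sum exactly one. Lower bound: the
mass distribution principle, comparing a multiple of `cantorMeasure` with Hausdorff measure. -/
theorem dimH_cantorLimitSet {N t : ℕ} {D : ℕ → ℕ → Finset ℕ} {α : ℝ}
    (hD : IsDigitChoice N t D) (ht : 0 < t) (hN : 1 < N) (hα : 0 < α)
    (hNt : (N : ℝ) ^ α = t) : dimH (cantorLimitSet N D) = ENNReal.ofReal α := by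
  have hN' : (1 : ℝ) < N := by exact_mod_cast hN
  have hcoe : ENNReal.ofReal α = (α.toNNReal : ℝ≥0∞) := rfl
  rw [hcoe]
  refine le_antisymm (dimH_le_of_hausdorffMeasure_ne_top ?_)
    (le_dimH_of_hausdorffMeasure_ne_zero ?_) <;>
    rw [Real.coe_toNNReal α hα.le]
  · have h := Measure.hausdorffMeasure_le_liminf_sum (X := ℝ) (β := ℕ)
      (ι := fun j => (cantorNodes N D j : Finset ℕ)) α (cantorLimitSet N D) (l := atTop)
      (fun j => ENNReal.ofReal ((((N : ℝ)⁻¹)) ^ j)) (by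
        have := (ENNReal.continuous_ofReal.tendsto 0).comp
          (tendsto_pow_atTop_nhds_zero_of_lt_one (inv_nonneg.2 (by linarith : (0 : ℝ) ≤ N))
            (inv_lt_one_of_one_lt₀ hN'))
        rwa [ENNReal.ofReal_zero] at this)
      (fun j a => Set.Icc (((a : ℕ) : ℝ) / (N : ℝ) ^ j) ((((a : ℕ) : ℝ) + 1) / (N : ℝ) ^ j))
      (Eventually.of_forall fun j a => by
        rw [Real.ediam_Icc, ← sub_div, add_sub_cancel_left, one_div, inv_pow])
      (Eventually.of_forall fun j x hx => by
        obtain ⟨a, ha, hxa⟩ := Set.mem_iUnion₂.1 (Set.mem_iInter.1 hx j)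
        exact Set.mem_iUnion.2 ⟨⟨a, ha⟩, hxa⟩)
    refine ne_top_of_le_ne_top (b := 1) (by simp) (h.trans ?_)
    have h1 : ∀ j : ℕ, ∑ a : (cantorNodes N D j : Finset ℕ),
        Metric.ediam (Set.Icc (((a : ℕ) : ℝ) / (N : ℝ) ^ j) ((((a : ℕ) : ℝ) + 1) / (N : ℝ) ^ j)) ^ α
        = 1 := by
      intro j
      have h2 : (ENNReal.ofReal (1 / (N : ℝ) ^ j)) ^ α = ((t : ℝ≥0∞) ^ j)⁻¹ := by
        rw [ENNReal.ofReal_rpow_of_pos (by positivity), one_div, Real.inv_rpow (by positivity),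
          ← Real.rpow_natCast, ← Real.rpow_mul (by positivity), mul_comm,
          Real.rpow_mul (by positivity), hNt, Real.rpow_natCast,
          ENNReal.ofReal_inv_of_pos (by positivity), ENNReal.ofReal_pow (by positivity),
          ENNReal.ofReal_natCast]
      simp_rw [Real.ediam_Icc, ← sub_div, add_sub_cancel_left, h2]
      rw [Finset.sum_const, Finset.card_univ, Fintype.card_coe, card_cantorNodes hD ht,
        nsmul_eq_mul]
      push_cast
      exact ENNReal.mul_inv_cancel (by positivity)
        (ENNReal.pow_ne_top (ENNReal.natCast_ne_top t))
    simp_rw [h1]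
    simp
  · have hle : (ENNReal.ofReal (4 * t))⁻¹ • cantorMeasure N t D ≤ μH[α] := by
      refine Measure.le_hausdorffMeasure α _ 1 (by norm_num) fun s hs => ?_
      rw [Measure.smul_apply, smul_eq_mul, mul_comm, ← div_eq_mul_inv]
      refine ENNReal.div_le_of_le_mul ?_
      rcases s.eq_empty_or_nonempty with rfl | ⟨y, hy⟩
      · simp
      have hfin : Metric.ediam s ≠ ⊤ := ne_top_of_le_ne_top (by simp) hs
      have key : ∀ r : ℝ, 0 < r → Metric.ediam s ≤ ENNReal.ofReal r →
          cantorMeasure N t D s ≤ ENNReal.ofReal (4 * t * r ^ α) := by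
        intro r hr hsr
        refine (measure_mono fun z hz => ?_).trans
          (cantorMeasure_closedBall_le_rpow hD ht hN hα.le hNt y r hr)
        have := (Metric.edist_le_ediam_of_mem hz hy).trans hsr
        rw [edist_dist, ENNReal.ofReal_le_ofReal_iff hr.le] at this
        exact this
      have hd : Metric.ediam s = ENNReal.ofReal (Metric.ediam s).toReal :=
        (ENNReal.ofReal_toReal hfin).symm
      set δ := (Metric.ediam s).toReal with hδ
      have hδ0 : 0 ≤ δ := ENNReal.toReal_nonneg
      -- The ball bound needs a positive radius, so it is used for `r > δ` and passed to the limit;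
      -- this includes sets of diameter zero.
      have hlim : Tendsto (fun r : ℝ => ENNReal.ofReal (4 * t * r ^ α)) (𝓝[>] δ)
          (𝓝 (ENNReal.ofReal (4 * t * δ ^ α))) := by
        refine (ENNReal.continuous_ofReal.tendsto _).comp ?_
        refine Tendsto.mono_left ?_ nhdsWithin_le_nhds
        exact ((Real.continuous_rpow_const hα.le).const_mul _).tendsto _
      have := ge_of_tendsto hlim (by
        filter_upwards [self_mem_nhdsWithin] with r hr
        have hr' : δ < r := hr
        refine key r (by linarith) ?_
        rw [hd]
        exact ENNReal.ofReal_le_ofReal hr'.le)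
      refine this.trans_eq ?_
      rw [hd, ENNReal.ofReal_rpow_of_nonneg hδ0 hα.le, ← ENNReal.ofReal_mul (by positivity),
        mul_comm]
    intro h0
    have h1 := hle (cantorLimitSet N D)
    have h0' : μH[α] (cantorLimitSet N D) = 0 := h0
    have h2 : cantorMeasure N t D (cantorLimitSet N D) = 1 := by
      rw [prob_compl_eq_zero_iff (isClosed_cantorLimitSet N D).measurableSet |>.1
        (cantorMeasure_compl_cantorLimitSet hD ht (by omega))]
    rw [h0', Measure.smul_apply, h2] at h1
    simp only [nonpos_iff_eq_zero, smul_eq_mul, mul_one, ENNReal.inv_eq_zero] at h1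
    exact ENNReal.ofReal_ne_top h1

/-! ### Digit choices with small exponential sums -/

/-- On `[-c, c]` the exponential lies below its chord. The linear part of the chord sums to zero,
which leaves `cosh c ≤ exp (c ^ 2 / 2)`. -/
theorem sum_exp_le {ι : Type*} (s : Finset ι) (f : ι → ℝ) {c : ℝ} (hc : 0 < c)
    (h0 : ∑ x ∈ s, f x = 0) (hb : ∀ x ∈ s, |f x| ≤ c) :
    ∑ x ∈ s, Real.exp (f x) ≤ s.card * Real.exp (c ^ 2 / 2) := by
  have h1 : ∀ x ∈ s, Real.exp (f x) ≤ Real.cosh c + f x * (Real.sinh c / c) := by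
    intro x hx
    obtain ⟨h2, h3⟩ := abs_le.1 (hb x hx)
    have := convexOn_exp.2 (Set.mem_univ c) (Set.mem_univ (-c))
      (div_nonneg (by linarith) (by linarith) : 0 ≤ (c + f x) / (2 * c))
      (div_nonneg (by linarith) (by linarith) : 0 ≤ (c - f x) / (2 * c))
      (by field_simp; ring)
    simp only [smul_eq_mul] at this
    have h4 : (c + f x) / (2 * c) * c + (c - f x) / (2 * c) * -c = f x := by field_simp; ring
    rw [h4] at this
    refine this.trans_eq ?_
    rw [Real.cosh_eq, Real.sinh_eq]
    field_simp
    ring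
  calc ∑ x ∈ s, Real.exp (f x) ≤ ∑ x ∈ s, (Real.cosh c + f x * (Real.sinh c / c)) :=
        Finset.sum_le_sum h1
    _ = s.card * Real.cosh c := by
        rw [Finset.sum_add_distrib, ← Finset.sum_mul, h0]
        simp
    _ ≤ _ := by gcongr; exact Real.cosh_le_exp_half_sq c

/-- A derandomized form of Hoeffding's inequality, for many sums at once. -/
theorem exists_choice_sum_exp_le {κ : Type*} (K : Finset κ) {N : ℕ} (hN : 0 < N)
    (f : ℕ → ℕ → κ → ℝ) {c : ℝ} (hc : 0 < c)
    (h0 : ∀ a k, ∑ x ∈ Finset.range N, f a x k = 0) (hb : ∀ a x k, |f a x k| ≤ c)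
    (A : Finset ℕ) :
    ∃ y : ℕ → ℕ, ∑ k ∈ K, Real.exp (∑ a ∈ A, f a (y a) k)
      ≤ K.card * Real.exp (A.card * (c ^ 2 / 2)) := by
  induction A using Finset.induction_on with
  | empty => exact ⟨fun _ => 0, by simp⟩
  | insert b A hbA ih =>
    obtain ⟨y, hy⟩ := ih
    -- Averaging the new choice over all `x` multiplies the total exponential moment by at most `exp
    -- (c ^ 2 / 2)`, so some `x` does no worse.
    have h1 : ∑ x ∈ Finset.range N, ∑ k ∈ K, Real.exp (∑ a ∈ A, f a (y a) k) * Real.exp (f b x k)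
        ≤ ∑ x ∈ Finset.range N, K.card * Real.exp ((A.card + 1) * (c ^ 2 / 2)) := by
      rw [Finset.sum_comm]
      calc _ ≤ ∑ k ∈ K, Real.exp (∑ a ∈ A, f a (y a) k) * (N * Real.exp (c ^ 2 / 2)) := by
            refine Finset.sum_le_sum fun k _ => ?_
            rw [← Finset.mul_sum]
            gcongr
            simpa using sum_exp_le (Finset.range N) (fun x => f b x k) hc (h0 b k)
              (fun x _ => hb b x k)
        _ ≤ (K.card * Real.exp (A.card * (c ^ 2 / 2))) * (N * Real.exp (c ^ 2 / 2)) := by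
            rw [← Finset.sum_mul]
            gcongr
        _ = _ := by
            rw [Finset.sum_const, Finset.card_range, nsmul_eq_mul, add_mul, Real.exp_add, one_mul]
            ring
    obtain ⟨x, _, hx⟩ := Finset.exists_le_of_sum_le (by simpa using hN.ne') h1
    refine ⟨Function.update y b x, ?_⟩
    rw [Finset.card_insert_of_notMem hbA]
    push_cast
    refine le_trans (le_of_eq ?_) hx
    refine Finset.sum_congr rfl fun k _ => ?_
    rw [Finset.sum_insert hbA, Function.update_self, ← Real.exp_add, add_comm]
    congr 2
    refine Finset.sum_congr rfl fun a ha => ?_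
    rw [Function.update_of_ne (by rintro rfl; exact hbA ha)]

/-! ### Exponential sums over digit sets -/

/-- The character `n ↦ e ^ (-2πi θ n)`. -/
noncomputable def charExp (θ x : ℝ) : ℂ := Complex.exp (((-(2 * Real.pi * θ * x) : ℝ) : ℂ) * Complex.I)

theorem norm_charExp (θ x : ℝ) : ‖charExp θ x‖ = 1 := Complex.norm_exp_ofReal_mul_I _

theorem charExp_add (θ x y : ℝ) : charExp θ (x + y) = charExp θ x * charExp θ y := by
  rw [charExp, charExp, charExp, ← Complex.exp_add]
  congr 1
  push_cast
  ring

theorem norm_charExp_sub_le (θ θ' x : ℝ) :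
    ‖charExp θ x - charExp θ' x‖ ≤ 2 * Real.pi * |x| * |θ - θ'| := by
  have h : charExp θ x = charExp θ' x * charExp (θ - θ') x := by
    rw [charExp, charExp, charExp, ← Complex.exp_add]
    congr 1
    push_cast
    ring
  rw [h, ← mul_sub_one, norm_mul, norm_charExp, one_mul, charExp, mul_comm]
  refine (Real.norm_exp_I_mul_ofReal_sub_one_le).trans_eq ?_
  rw [norm_neg, Real.norm_eq_abs, abs_mul, abs_mul, abs_of_pos Real.two_pi_pos]
  ring

theorem charExp_fract (θ : ℝ) (n : ℕ) : charExp (Int.fract θ) n = charExp θ n := by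
  have h : charExp θ n = charExp (Int.fract θ) n *
      Complex.exp (((-(⌊θ⌋ * n) : ℤ) : ℂ) * (2 * Real.pi * Complex.I)) := by
    rw [charExp, charExp, ← Complex.exp_add]
    congr 1
    have : (θ : ℂ) = (⌊θ⌋ : ℂ) + (Int.fract θ : ℝ) := by
      have := Int.floor_add_fract θ
      exact_mod_cast this.symm
    push_cast
    rw [this]
    ring
  rw [h, Complex.exp_int_mul_two_pi_mul_I, mul_one]

/-- The deviation of the exponential sum over a digit set from the one over all digits. -/
noncomputable def digitDeviation (N t : ℕ) (B : Finset ℕ) (θ : ℝ) : ℂ :=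
  ∑ d ∈ B, charExp θ d - (t / N : ℝ) * ∑ d ∈ Finset.range N, charExp θ d

theorem div_mul_self_le {x y : ℝ} (hx : 0 ≤ x) : x / y * y ≤ x := by
  rcases eq_or_ne y 0 with rfl | hy
  · simpa using hx
  · rw [div_mul_cancel₀ _ hy]

theorem norm_digitDeviation_le {N t : ℕ} {B : Finset ℕ} (hB : B.card = t) (θ : ℝ) :
    ‖digitDeviation N t B θ‖ ≤ 2 * t := by
  have h1 : ‖∑ d ∈ B, charExp θ d‖ ≤ t := by
    refine (norm_sum_le _ _).trans ?_
    simp [norm_charExp, hB]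
  have h2 : ‖((t / N : ℝ) : ℂ) * ∑ d ∈ Finset.range N, charExp θ d‖ ≤ t := by
    rw [norm_mul, Complex.norm_real, Real.norm_of_nonneg (by positivity)]
    have : ‖∑ d ∈ Finset.range N, charExp θ d‖ ≤ N := by
      refine (norm_sum_le _ _).trans ?_
      simp [norm_charExp]
    calc (t / N : ℝ) * _ ≤ (t / N : ℝ) * N := by gcongr
      _ ≤ t := div_mul_self_le (by positivity)
  calc _ ≤ _ := norm_sub_le _ _
    _ ≤ _ := by linarith

/-- The cyclic translate of the digits `{0, …, t - 1}` by `x` modulo `N`. -/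
def shiftDigits (N t x : ℕ) : Finset ℕ := (Finset.range t).image fun i => (i + x) % N

theorem shiftDigits_injOn {N t : ℕ} (htN : t ≤ N) (x : ℕ) :
    Set.InjOn (fun i => (i + x) % N) (Finset.range t : Set ℕ) := by
  intro i hi k hk h
  simp only [Finset.coe_range, Set.mem_Iio] at hi hk
  have h1 : i ≡ k [MOD N] := Nat.ModEq.add_right_cancel' x h
  exact Nat.ModEq.eq_of_lt_of_lt h1 (by omega) (by omega)

theorem card_shiftDigits {N t : ℕ} (htN : t ≤ N) (x : ℕ) : (shiftDigits N t x).card = t := by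
  rw [shiftDigits, Finset.card_image_of_injOn (shiftDigits_injOn htN x), Finset.card_range]

theorem shiftDigits_subset {N t : ℕ} (hN : 0 < N) (x : ℕ) :
    shiftDigits N t x ⊆ Finset.range N := by
  intro d hd
  obtain ⟨i, _, rfl⟩ := Finset.mem_image.1 hd
  exact Finset.mem_range.2 (Nat.mod_lt _ hN)

theorem shiftDigits_full {N : ℕ} (hN : 0 < N) (x : ℕ) :
    shiftDigits N N x = Finset.range N :=
  Finset.eq_of_subset_of_card_le (shiftDigits_subset hN x)
    (by rw [card_shiftDigits le_rfl, Finset.card_range])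

/-- For fixed `i`, the residue `(i + x) % N` runs once over all digits as `x` does, so an average
cyclic shift is uniform. This is the mean-zero condition for the Hoeffding argument. -/
theorem sum_digitDeviation_shiftDigits {N t : ℕ} (hN : 0 < N) (htN : t ≤ N) (θ : ℝ) :
    ∑ x ∈ Finset.range N, digitDeviation N t (shiftDigits N t x) θ = 0 := by
  have h1 : ∀ x, ∑ d ∈ shiftDigits N t x, charExp θ d
      = ∑ i ∈ Finset.range t, charExp θ ((i + x) % N : ℕ) := fun x => by
    rw [shiftDigits, Finset.sum_image (shiftDigits_injOn htN x)]
  have h2 : ∀ i, ∑ x ∈ Finset.range N, charExp θ ((i + x) % N : ℕ)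
      = ∑ d ∈ Finset.range N, charExp θ d := fun i => by
    conv_rhs =>
      rw [← shiftDigits_full hN i, shiftDigits, Finset.sum_image (shiftDigits_injOn le_rfl i)]
    exact Finset.sum_congr rfl fun x _ => by rw [add_comm]
  have hN' : (N : ℂ) ≠ 0 := by exact_mod_cast hN.ne'
  simp only [digitDeviation]
  rw [Finset.sum_sub_distrib, Finset.sum_congr rfl fun x _ => h1 x, Finset.sum_comm,
    Finset.sum_congr rfl fun i _ => h2 i]
  simp only [Finset.sum_const, Finset.card_range, nsmul_eq_mul]
  push_cast
  field_simp
  ring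

/-- The exponential sum measuring the change from generation `j` to generation `j + 1`. -/
noncomputable def levelDeviation (N t : ℕ) (A : Finset ℕ) (G : ℕ → Finset ℕ) (θ : ℝ) : ℂ :=
  ∑ a ∈ A, charExp θ (N * a : ℕ) * digitDeviation N t (G a) θ

/-- The four real parts are `± z.re` and `± z.im`, so bounding a complex modulus costs four
one-sided real bounds, the kind that exponential moments provide. -/
theorem norm_le_of_re_le {z : ℂ} {R : ℝ}
    (h : ∀ i : Fin 4, (Complex.I ^ (i : ℕ) * z).re ≤ R) : ‖z‖ ≤ 2 * R := by
  have h0 := h 0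
  have h1 := h 1
  have h2 := h 2
  have h3 := h 3
  simp [pow_succ] at h0 h1 h2 h3
  refine (Complex.norm_le_abs_re_add_abs_im z).trans ?_
  have := abs_le.2 ⟨by linarith, h0⟩
  have := abs_le.2 ⟨by linarith, h3⟩
  linarith

/-- Nodes in `Q` are frozen and contribute at most `2 t` each. The shifts at the remaining nodes
come from the derandomized Hoeffding bound over `4 M` tests, whence `log (4 M)`. -/
theorem exists_levelDeviation_le {N t : ℕ} (hN : 0 < N) (ht : 0 < t) (htN : t ≤ N)
    (A Q : Finset ℕ) {M : ℕ} (hM : 0 < M) {r : ℝ} (hr : 0 < r) (hA : (A.card : ℝ) ≤ r ^ 2)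
    (hQ : (Q.card : ℝ) ≤ r) :
    ∃ G : ℕ → Finset ℕ, (∀ a, G a ⊆ Finset.range N ∧ (G a).card = t) ∧
      (∀ a ∈ Q, G a = Finset.range t) ∧
      ∀ m < M, ‖levelDeviation N t A G ((m : ℝ) / M)‖
        ≤ t * r * (4 + 4 * Real.log (4 * M)) := by
  classical
  -- With this scaling each term is at most `1 / r`; as there are at most `r ^ 2` of them, the
  -- Hoeffding exponent is at most `1 / 2`.
  set lam : ℝ := 1 / (2 * t * r) with hlam
  have ht' : (0 : ℝ) < t := by exact_mod_cast ht
  have hlam0 : 0 < lam := by positivity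
  let Z : ℕ → ℕ → ℕ → ℂ := fun a x m =>
    charExp ((m : ℝ) / M) (N * a : ℕ) * digitDeviation N t (shiftDigits N t x) ((m : ℝ) / M)
  let f : ℕ → ℕ → ℕ × Fin 4 → ℝ := fun a x k =>
    lam * (Complex.I ^ (k.2 : ℕ) * Z a x k.1).re
  have hf0 : ∀ a k, ∑ x ∈ Finset.range N, f a x k = 0 := by
    intro a k
    simp only [f, Z]
    rw [← Finset.mul_sum, ← Complex.re_sum, ← Finset.mul_sum, ← Finset.mul_sum,
      sum_digitDeviation_shiftDigits hN htN]
    simp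
  have hfb : ∀ a x k, |f a x k| ≤ 1 / r := by
    intro a x k
    simp only [f, Z]
    rw [abs_mul, abs_of_pos hlam0]
    calc lam * |_| ≤ lam * ‖_‖ := by gcongr; exact Complex.abs_re_le_norm _
      _ ≤ lam * (2 * t) := by
        gcongr
        rw [norm_mul, norm_mul, norm_pow, Complex.norm_I, one_pow, norm_charExp, one_mul, one_mul]
        exact norm_digitDeviation_le (card_shiftDigits htN x) _
      _ = 1 / r := by rw [hlam]; field_simp
  obtain ⟨y, hy⟩ := exists_choice_sum_exp_le (Finset.range M ×ˢ (Finset.univ : Finset (Fin 4))) hN f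
    (by positivity : 0 < 1 / r) hf0 hfb (A \ Q)
  have hdig : ∀ a, (if a ∈ Q then Finset.range t else shiftDigits N t (y a)) ⊆ Finset.range N ∧
      (if a ∈ Q then Finset.range t else shiftDigits N t (y a)).card = t := by
    intro a
    split_ifs
    · exact ⟨Finset.range_subset_range.2 htN, Finset.card_range t⟩
    · exact ⟨shiftDigits_subset hN _, card_shiftDigits htN _⟩
  refine ⟨fun a => if a ∈ Q then Finset.range t else shiftDigits N t (y a), hdig,
    fun a ha => if_pos ha, fun m hm => ?_⟩
  have hM' : (0 : ℝ) < M := by exact_mod_cast hM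
  have h1 : ‖∑ a ∈ A \ Q, Z a (y a) m‖ ≤ 2 * ((Real.log (4 * M) + 1 / 2) / lam) := by
    refine norm_le_of_re_le fun i => ?_
    have h2 : Real.exp (∑ a ∈ A \ Q, f a (y a) (m, i)) ≤ Real.exp (Real.log (4 * M) + 1 / 2) := by
      refine (Finset.single_le_sum (f := fun k => Real.exp (∑ a ∈ A \ Q, f a (y a) k))
        (fun k _ => (Real.exp_pos _).le)
        (Finset.mem_product.2 ⟨Finset.mem_range.2 hm, Finset.mem_univ i⟩)).trans (hy.trans ?_)
      rw [Real.exp_add, Real.exp_log (by positivity), Finset.card_product, Finset.card_range,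
        Finset.card_univ, Fintype.card_fin]
      push_cast
      rw [mul_comm (M : ℝ) 4]
      gcongr
      have : ((A \ Q).card : ℝ) ≤ r ^ 2 :=
        le_trans (by exact_mod_cast Finset.card_le_card Finset.sdiff_subset) hA
      calc ((A \ Q).card : ℝ) * ((1 / r) ^ 2 / 2) ≤ r ^ 2 * ((1 / r) ^ 2 / 2) := by gcongr
        _ = 1 / 2 := by field_simp
    rw [Real.exp_le_exp] at h2
    simp only [f] at h2
    rw [← Finset.mul_sum, ← Complex.re_sum, ← Finset.mul_sum] at h2
    rw [le_div_iff₀ hlam0, mul_comm]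
    exact h2
  have h3 : ‖levelDeviation N t A
      (fun a => if a ∈ Q then Finset.range t else shiftDigits N t (y a)) ((m : ℝ) / M)‖
      ≤ 2 * ((Real.log (4 * M) + 1 / 2) / lam) + r * (2 * t) := by
    rw [levelDeviation, ← Finset.sum_sdiff (Finset.inter_subset_left (s₁ := A) (s₂ := Q)),
      Finset.sdiff_inter_self_left]
    refine (norm_add_le _ _).trans (add_le_add ?_ ?_)
    · refine le_trans (le_of_eq ?_) h1
      congr 1
      refine Finset.sum_congr rfl fun a ha => ?_
      simp only [Z, if_neg (Finset.mem_sdiff.1 ha).2]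
    · calc _ ≤ ∑ a ∈ A ∩ Q, (2 * t : ℝ) := by
            refine norm_sum_le_of_le _ fun a _ => ?_
            rw [norm_mul, norm_charExp, one_mul]
            exact norm_digitDeviation_le (hdig a).2 _
        _ = (A ∩ Q).card * (2 * t : ℝ) := by simp
        _ ≤ _ := by
            gcongr
            exact le_trans (by exact_mod_cast Finset.card_le_card Finset.inter_subset_right) hQ
  refine h3.trans_eq ?_
  rw [hlam]
  field_simp
  ring

theorem levelDeviation_fract (N t : ℕ) (A : Finset ℕ) (G : ℕ → Finset ℕ) (θ : ℝ) :
    levelDeviation N t A G (Int.fract θ) = levelDeviation N t A G θ := by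
  simp only [levelDeviation, digitDeviation, charExp_fract]

theorem levelDeviation_eq (N t : ℕ) (A : Finset ℕ) (G : ℕ → Finset ℕ) (θ : ℝ) :
    levelDeviation N t A G θ = ∑ a ∈ A, (∑ d ∈ G a, charExp θ (N * a + d : ℕ)
      - (t / N : ℝ) * ∑ d ∈ Finset.range N, charExp θ (N * a + d : ℕ)) := by
  refine Finset.sum_congr rfl fun a _ => ?_
  have h : ∀ d : ℕ, charExp θ (N * a + d : ℕ) = charExp θ (N * a : ℕ) * charExp θ d := fun d => by
    rw [← charExp_add, Nat.cast_add]
  simp only [h, digitDeviation]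
  rw [← Finset.mul_sum, ← Finset.mul_sum]
  ring

theorem norm_levelDeviation_sub_le {N t j : ℕ} {A : Finset ℕ} {G : ℕ → Finset ℕ}
    (hG : ∀ a, G a ⊆ Finset.range N ∧ (G a).card = t) (hA : A ⊆ Finset.range (N ^ j))
    (θ θ' : ℝ) :
    ‖levelDeviation N t A G θ - levelDeviation N t A G θ'‖
      ≤ A.card * (2 * t * (2 * Real.pi * (N : ℝ) ^ (j + 1) * |θ - θ'|)) := by
  have hb : ∀ a ∈ A, ∀ d ∈ Finset.range N,
      ‖charExp θ (N * a + d : ℕ) - charExp θ' (N * a + d : ℕ)‖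
        ≤ 2 * Real.pi * (N : ℝ) ^ (j + 1) * |θ - θ'| := by
    intro a ha d hd
    refine (norm_charExp_sub_le _ _ _).trans ?_
    have h1 := Finset.mem_range.1 (hA ha)
    have h2 := Finset.mem_range.1 hd
    have h3 : N * a + d ≤ N ^ (j + 1) := by
      calc N * a + d ≤ N * a + N := by omega
        _ = N * (a + 1) := by ring
        _ ≤ N * N ^ j := Nat.mul_le_mul_left _ h1
        _ = N ^ (j + 1) := by ring
    rw [abs_of_nonneg (by positivity : (0 : ℝ) ≤ (N * a + d : ℕ))]
    gcongr
    · exact_mod_cast h3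
  set b := 2 * Real.pi * (N : ℝ) ^ (j + 1) * |θ - θ'| with hbdef
  have hb0 : 0 ≤ b := by positivity
  rw [levelDeviation_eq, levelDeviation_eq, ← Finset.sum_sub_distrib]
  refine (norm_sum_le_of_le _ (f := _) (n := fun _ => 2 * t * b) fun a ha => ?_).trans_eq (by simp)
  have h1 : ‖∑ d ∈ G a, charExp θ (N * a + d : ℕ) - ∑ d ∈ G a, charExp θ' (N * a + d : ℕ)‖
      ≤ t * b := by
    rw [← Finset.sum_sub_distrib]
    refine (norm_sum_le_of_le _ fun d hd => hb a ha d ((hG a).1 hd)).trans_eq ?_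
    simp [(hG a).2]
  have h2 : ‖((t / N : ℝ) : ℂ) * (∑ d ∈ Finset.range N, charExp θ (N * a + d : ℕ)
      - ∑ d ∈ Finset.range N, charExp θ' (N * a + d : ℕ))‖ ≤ t * b := by
    rw [norm_mul, Complex.norm_real, Real.norm_of_nonneg (by positivity),
      ← Finset.sum_sub_distrib]
    have h3 := norm_sum_le_of_le _ fun d hd => hb a ha d hd
    simp only [Finset.sum_const, Finset.card_range, nsmul_eq_mul] at h3
    calc _ ≤ (t / N : ℝ) * (N * b) := by gcongr
      _ = (t / N : ℝ) * N * b := by ring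
      _ ≤ t * b := by
        gcongr
        exact div_mul_self_le (by positivity)
  calc _ = ‖(∑ d ∈ G a, charExp θ (N * a + d : ℕ) - ∑ d ∈ G a, charExp θ' (N * a + d : ℕ))
        - ((t / N : ℝ) : ℂ) * (∑ d ∈ Finset.range N, charExp θ (N * a + d : ℕ)
      - ∑ d ∈ Finset.range N, charExp θ' (N * a + d : ℕ))‖ := by congr 1; ring
    _ ≤ _ := norm_sub_le _ _
    _ ≤ _ := by linarith

/-- The grid bound applies with `r = s ^ j`, since `t ^ j = r ^ 2`. Periodicity reduces to `θ ∈ [0,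
1)`, and a Lipschitz estimate fills in between grid points. -/
theorem exists_levelDeviation_le_all {N s t j : ℕ} (hs : 0 < s) (hst : t = s ^ 2) (htN : t ≤ N)
    {A Q : Finset ℕ} (hA : A ⊆ Finset.range (N ^ j)) (hAc : A.card ≤ t ^ j)
    (hQ : Q.card ≤ s ^ j) :
    ∃ G : ℕ → Finset ℕ, (∀ a, G a ⊆ Finset.range N ∧ (G a).card = t) ∧
      (∀ a ∈ Q, G a = Finset.range t) ∧
      ∀ θ, ‖levelDeviation N t A G θ‖
        ≤ (8 + 4 * Real.pi + 8 * Real.log N + 4 * Real.log 4) * (j + 1) * (t * (s : ℝ) ^ j) := by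
  have ht : 0 < t := by rw [hst]; positivity
  have hN : 0 < N := by omega
  have hN1 : (1 : ℝ) ≤ N := by exact_mod_cast hN
  have hs1 : (1 : ℝ) ≤ s := by exact_mod_cast hs
  have ht1 : (1 : ℝ) ≤ t := by exact_mod_cast ht
  -- The Lipschitz constant is at most `4π N ^ (2 (j + 1))`, so this grid size keeps the error below
  -- `4π`, while `log M` is linear in `j + 1`.
  have hM : 0 < N ^ (2 * (j + 1)) := by positivity
  have hAc' : (A.card : ℝ) ≤ (t : ℝ) ^ j := by exact_mod_cast hAc
  obtain ⟨G, hG, hGQ, hb⟩ := exists_levelDeviation_le hN ht htN A Q hM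
    (r := (s : ℝ) ^ j) (by positivity)
    (by rw [← pow_mul, mul_comm, pow_mul]; rw [hst] at hAc'; exact_mod_cast hAc')
    (by exact_mod_cast hQ)
  refine ⟨G, hG, hGQ, fun θ => ?_⟩
  set M : ℕ := N ^ (2 * (j + 1)) with hMdef
  have hM' : (0 : ℝ) < M := by exact_mod_cast hM
  rw [← levelDeviation_fract]
  set φ := Int.fract θ with hφ
  have hφ0 : 0 ≤ φ := Int.fract_nonneg θ
  have hφ1 : φ < 1 := Int.fract_lt_one θ
  set m := ⌊φ * M⌋₊ with hm
  have hmM : m < M := by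
    rw [hm, Nat.floor_lt (by positivity)]
    nlinarith
  have h1 := hb m hmM
  have hm1 : (m : ℝ) ≤ φ * M := Nat.floor_le (by positivity)
  have hm2 : φ * M < m + 1 := Nat.lt_floor_add_one _
  have h2 := norm_levelDeviation_sub_le hG hA φ ((m : ℝ) / M)
  have h3 : |φ - (m : ℝ) / M| ≤ 1 / M := by
    have : φ - (m : ℝ) / M = (φ * M - m) / M := by field_simp
    rw [this, abs_div, abs_of_pos hM', abs_of_nonneg (by linarith)]
    gcongr
    linarith
  have h4 : (A.card : ℝ) * (2 * t * (2 * Real.pi * (N : ℝ) ^ (j + 1) * |φ - (m : ℝ) / M|))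
      ≤ 4 * Real.pi := by
    calc _ ≤ (N : ℝ) ^ j * (2 * N * (2 * Real.pi * (N : ℝ) ^ (j + 1) * (1 / M))) := by
          gcongr
          · exact hAc'.trans (pow_le_pow_left₀ (by positivity) (by exact_mod_cast htN) j)
      _ = 4 * Real.pi := by
          rw [hMdef]
          push_cast
          field_simp
          ring
  have h5 : Real.log (4 * M) ≤ (j + 1) * (Real.log 4 + 2 * Real.log N) := by
    rw [Real.log_mul (by norm_num) hM'.ne', hMdef]
    push_cast
    rw [Real.log_pow]
    push_cast
    have : 0 ≤ Real.log 4 := Real.log_nonneg (by norm_num)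
    have : 0 ≤ (j : ℝ) * Real.log 4 := by positivity
    linarith
  have h6 : 1 ≤ t * (s : ℝ) ^ j := by
    have : 1 ≤ (s : ℝ) ^ j := one_le_pow₀ hs1
    nlinarith
  have h7 : ‖levelDeviation N t A G φ‖ ≤ t * (s : ℝ) ^ j * (4 + 4 * Real.log (4 * M))
      + 4 * Real.pi := by
    have := norm_add_le (levelDeviation N t A G φ - levelDeviation N t A G ((m : ℝ) / M))
      (levelDeviation N t A G ((m : ℝ) / M))
    rw [sub_add_cancel] at this
    linarith
  refine h7.trans ?_
  have hj : (0 : ℝ) ≤ j := by positivity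
  have hpi := Real.pi_pos
  calc t * (s : ℝ) ^ j * (4 + 4 * Real.log (4 * M)) + 4 * Real.pi
      ≤ t * (s : ℝ) ^ j * (4 + 4 * ((j + 1) * (Real.log 4 + 2 * Real.log N)))
        + 4 * Real.pi * (t * (s : ℝ) ^ j) := by
        refine add_le_add (by gcongr) ?_
        exact le_mul_of_one_le_right (by positivity) h6
    _ = (t * (s : ℝ) ^ j) * (4 + 4 * Real.pi + (j + 1) * (4 * Real.log 4 + 8 * Real.log N)) := by
        ring
    _ ≤ (t * (s : ℝ) ^ j) * ((8 + 4 * Real.pi + 8 * Real.log N + 4 * Real.log 4) * (j + 1)) := by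
        gcongr
        nlinarith
    _ = _ := by ring

theorem card_cantorNodes_const_le (N : ℕ) (P : Finset ℕ) (j : ℕ) :
    (cantorNodes N (fun _ _ => P) j).card ≤ P.card ^ j := by
  induction j with
  | zero => simp [cantorNodes]
  | succ j ih =>
    calc _ ≤ _ := Finset.card_biUnion_le
      _ ≤ ∑ a ∈ cantorNodes N (fun _ _ => P) j, P.card :=
          Finset.sum_le_sum fun a _ => Finset.card_image_le
      _ = (cantorNodes N (fun _ _ => P) j).card * P.card := by simp
      _ ≤ P.card ^ j * P.card := Nat.mul_le_mul_right _ ih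
      _ = _ := by ring

/-- The generations of a construction whose digits are chosen depending on the present one. -/
def adaptiveNodes (N : ℕ) (G : ℕ → Finset ℕ → ℕ → Finset ℕ) : ℕ → Finset ℕ
  | 0 => {0}
  | j + 1 => (adaptiveNodes N G j).biUnion fun a =>
      (G j (adaptiveNodes N G j) a).image fun d => N * a + d

/-- The digits at generation `j` depend on the whole node set there. The recursion is therefore run
on node sets first, and is then recognised as an ordinary digit choice. -/
theorem cantorNodes_adaptive (N : ℕ) (G : ℕ → Finset ℕ → ℕ → Finset ℕ) (j : ℕ) :
    cantorNodes N (fun j a => G j (adaptiveNodes N G j) a) j = adaptiveNodes N G j := by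
  induction j with
  | zero => rfl
  | succ j ih => rw [cantorNodes, adaptiveNodes, ih]

theorem exists_digitChoice {N s t : ℕ} (hs : 0 < s) (hst : t = s ^ 2) (htN : t ≤ N) :
    ∃ (D : ℕ → ℕ → Finset ℕ) (K : ℝ), IsDigitChoice N t D ∧
      (∀ j, cantorNodes N (fun _ _ => Finset.range s) j ⊆ cantorNodes N D j) ∧
      ∀ j θ, ‖levelDeviation N t (cantorNodes N D j) (D j) θ‖
        ≤ K * (j + 1) * (t * (s : ℝ) ^ j) := by
  set K := 8 + 4 * Real.pi + 8 * Real.log N + 4 * Real.log 4 with hK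
  have ht : 0 < t := by rw [hst]; positivity
  have hex : ∀ (j : ℕ) (A : Finset ℕ), ∃ G : ℕ → Finset ℕ,
      (∀ a, G a ⊆ Finset.range N ∧ (G a).card = t) ∧
      (∀ a ∈ cantorNodes N (fun _ _ => Finset.range s) j, G a = Finset.range t) ∧
      (A ⊆ Finset.range (N ^ j) → A.card ≤ t ^ j → ∀ θ, ‖levelDeviation N t A G θ‖
        ≤ K * (j + 1) * (t * (s : ℝ) ^ j)) := by
    intro j A
    -- Only sets of this size occur as generations; a default value elsewhere makes the choice
    -- total.
    by_cases h : A ⊆ Finset.range (N ^ j) ∧ A.card ≤ t ^ j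
    · obtain ⟨G, h1, h2, h3⟩ := exists_levelDeviation_le_all hs hst htN h.1 h.2
        (by simpa using card_cantorNodes_const_le N (Finset.range s) j)
      exact ⟨G, h1, h2, fun _ _ => h3⟩
    · exact ⟨fun _ => Finset.range t,
        fun _ => ⟨Finset.range_subset_range.2 htN, Finset.card_range t⟩, fun _ _ => rfl,
        fun h1 h2 => absurd ⟨h1, h2⟩ h⟩
  choose G h1 h2 h3 using hex
  have hD : IsDigitChoice N t fun j a => G j (adaptiveNodes N G j) a :=
    ⟨fun j a => (h1 _ _ a).1, fun j a => (h1 _ _ a).2⟩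
  refine ⟨fun j a => G j (adaptiveNodes N G j) a, K, hD, fun j => ?_, fun j θ => ?_⟩
  · induction j with
    | zero => exact le_rfl
    | succ j ih =>
      intro b hb
      obtain ⟨a, ha, d, hd, rfl⟩ := mem_cantorNodes_succ.1 hb
      refine mem_cantorNodes_succ.2 ⟨a, ih ha, d, ?_, rfl⟩
      -- A structured node carries all digits below `t = s ^ 2`, hence those below `s`.
      rw [h2 _ _ a ha, Finset.mem_range]
      have := Finset.mem_range.1 hd
      nlinarith
  · rw [cantorNodes_adaptive]
    refine h3 j _ (fun a ha => ?_) ?_ θ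
    · rw [← cantorNodes_adaptive] at ha
      exact Finset.mem_range.2 (cantorNodes_lt hD ha)
    · rw [← cantorNodes_adaptive, card_cantorNodes hD ht]

/-! ### Fourier decay -/

theorem continuous_charExp (θ : ℝ) : Continuous (charExp θ) := by
  unfold charExp
  fun_prop

theorem charExp_zero_right (θ : ℝ) : charExp θ 0 = 1 := by simp [charExp]

theorem charExp_div (θ x y : ℝ) : charExp θ (x / y) = charExp (θ / y) x := by
  rw [charExp, charExp]
  congr 3
  ring

theorem charExp_mul (θ x y : ℝ) : charExp θ (y * x) = charExp (y * θ) x := by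
  rw [charExp, charExp]
  congr 3
  ring

theorem fourierOf_eq (μ : Measure ℝ) (f : ℝ → ℂ) (ξ : ℝ) :
    fourierOf μ f ξ = ∫ x, charExp ξ x * f x ∂μ := by
  rw [fourierOf, Fourier.fourierIntegral_def]
  refine integral_congr_ae (ae_of_all _ fun x => ?_)
  simp only [Circle.smul_def, smul_eq_mul, Real.fourierChar_apply, charExp]
  congr 4
  ring

/-- The Fourier transform of the uniform measure on `[0, 1]`. -/
noncomputable def unitFourier (η : ℝ) : ℂ := ∫ v in (0 : ℝ)..1, charExp η v

/-- Add the trivial bound `1` to the bound `1` for `|η| * ‖unitFourier η‖`, which comes from the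
explicit antiderivative. -/
theorem norm_unitFourier_le (η : ℝ) : ‖unitFourier η‖ ≤ 2 / (1 + |η|) := by
  have h1 : ‖unitFourier η‖ ≤ 1 := by
    simpa [unitFourier] using intervalIntegral.norm_integral_le_of_norm_le_const
      (a := (0 : ℝ)) (b := 1) (f := charExp η) (C := 1) (fun v _ => (norm_charExp η v).le)
  have h2 : |η| * ‖unitFourier η‖ ≤ 1 := by
    rcases eq_or_ne η 0 with rfl | hη
    · simp
    set c : ℂ := ((-(2 * Real.pi * η) : ℝ) : ℂ) * Complex.I with hc
    have hc0 : c ≠ 0 := by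
      rw [hc]
      refine mul_ne_zero ?_ Complex.I_ne_zero
      rw [Complex.ofReal_ne_zero]
      have := Real.pi_pos
      exact neg_ne_zero.2 (by positivity)
    have hcn : ‖c‖ = 2 * Real.pi * |η| := by
      rw [hc, norm_mul, Complex.norm_I, mul_one, Complex.norm_real, norm_neg, Real.norm_eq_abs,
        abs_mul, abs_of_pos Real.two_pi_pos]
    have h3 : ∀ v : ℝ, charExp η v = Complex.exp (c * v) := fun v => by
      rw [charExp, hc]
      congr 1
      push_cast
      ring
    have h4 : unitFourier η = (charExp η 1 - charExp η 0) / c := by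
      rw [unitFourier]
      simp_rw [h3]
      exact integral_exp_mul_complex hc0
    have h5 : ‖charExp η 1 - charExp η 0‖ ≤ 2 := by
      refine (norm_sub_le _ _).trans ?_
      rw [norm_charExp, norm_charExp]
      norm_num
    have hη' : 0 < |η| := abs_pos.2 hη
    rw [h4, norm_div, hcn, ← mul_div_assoc, div_le_one (by have := Real.pi_pos; positivity)]
    nlinarith [Real.pi_gt_three]
  rw [le_div_iff₀ (by positivity)]
  linarith

/-- Cutting an interval into `N` equal pieces does not change its uniform measure. This is why
`digitDeviation` subtracts `t / N` times the full digit sum: that term reproduces the coarser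
generation. -/
theorem unitFourier_mul {N : ℕ} (hN : 0 < N) (η : ℝ) :
    unitFourier (N * η) = (1 / N : ℝ) * ((∑ d ∈ Finset.range N, charExp η d) * unitFourier η) := by
  have hN' : (N : ℝ) ≠ 0 := by exact_mod_cast hN.ne'
  have h1 : ∀ d : ℕ, ∫ v in (d : ℝ)..((d + 1 : ℕ) : ℝ), charExp η v
      = charExp η d * unitFourier η := by
    intro d
    rw [unitFourier, ← intervalIntegral.integral_const_mul]
    simp_rw [← charExp_add]
    rw [intervalIntegral.integral_comp_add_left (fun v => charExp η v)]
    simp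
  rw [Finset.sum_mul, ← Finset.sum_congr rfl fun d _ => h1 d,
    intervalIntegral.sum_integral_adjacent_intervals (a := fun d : ℕ => (d : ℝ))
      fun d _ => (continuous_charExp η).intervalIntegrable _ _]
  rw [unitFourier]
  simp_rw [← charExp_mul]
  rw [intervalIntegral.integral_comp_mul_left (fun v => charExp η v) hN']
  simp

theorem sum_cantorNodes_succ {N t : ℕ} {D : ℕ → ℕ → Finset ℕ} (hD : IsDigitChoice N t D)
    {E : Type*} [AddCommMonoid E] (j : ℕ) (h : ℕ → E) :
    ∑ b ∈ cantorNodes N D (j + 1), h b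
      = ∑ a ∈ cantorNodes N D j, ∑ d ∈ D j a, h (N * a + d) := by
  rw [cantorNodes, Finset.sum_biUnion]
  · refine Finset.sum_congr rfl fun a _ => ?_
    rw [Finset.sum_image]
    intro x _ y _ hxy
    exact Nat.add_left_cancel hxy
  · intro a _ b _ hab
    rw [Function.onFun, Finset.disjoint_left]
    intro c hc hc'
    obtain ⟨x, hx, rfl⟩ := Finset.mem_image.1 hc
    obtain ⟨y, hy, hxy⟩ := Finset.mem_image.1 hc'
    have hx' := Finset.mem_range.1 (hD.subset_range _ _ hx)
    have hy' := Finset.mem_range.1 (hD.subset_range _ _ hy)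
    apply hab
    have hN : 0 < N := by omega
    have h1 := congrArg (· / N) hxy
    simp only [Nat.mul_add_div hN, Nat.div_eq_of_lt hx', Nat.div_eq_of_lt hy', add_zero] at h1
    exact h1.symm

theorem cellAverage_charExp (N : ℕ) (ξ : ℝ) (j a : ℕ) :
    cellAverage N (charExp ξ) j a
      = charExp (ξ / (N : ℝ) ^ j) a * unitFourier (ξ / (N : ℝ) ^ j) := by
  rw [cellAverage, unitFourier, ← intervalIntegral.integral_const_mul]
  simp_rw [charExp_div, charExp_add]

/-- The Fourier transform of the approximating measure of generation `j`. -/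
noncomputable def approxFourier (N t : ℕ) (D : ℕ → ℕ → Finset ℕ) (ξ : ℝ) (j : ℕ) : ℂ :=
  ((t : ℝ) ^ j)⁻¹ • ∑ a ∈ cantorNodes N D j, cellAverage N (charExp ξ) j a

theorem approxFourier_succ_sub {N t : ℕ} {D : ℕ → ℕ → Finset ℕ} (hD : IsDigitChoice N t D)
    (ht : 0 < t) (hN : 0 < N) (ξ : ℝ) (j : ℕ) :
    approxFourier N t D ξ (j + 1) - approxFourier N t D ξ j
      = ((t : ℝ) ^ (j + 1))⁻¹ • (unitFourier (ξ / (N : ℝ) ^ (j + 1)) *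
        levelDeviation N t (cantorNodes N D j) (D j) (ξ / (N : ℝ) ^ (j + 1))) := by
  set η := ξ / (N : ℝ) ^ (j + 1) with hη
  have hN' : (N : ℂ) ≠ 0 := by exact_mod_cast hN.ne'
  have ht' : (t : ℂ) ≠ 0 := by exact_mod_cast ht.ne'
  have h1 : ξ / (N : ℝ) ^ j = N * η := by
    have : (N : ℝ) ≠ 0 := by exact_mod_cast hN.ne'
    rw [hη, pow_succ]
    field_simp
  have h2 : ∀ a d : ℕ, charExp η (N * a + d : ℕ) = charExp (N * η) a * charExp η d :=
    fun a d => by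
      push_cast
      rw [charExp_add, charExp_mul]
  rw [approxFourier, approxFourier, levelDeviation_eq]
  simp only [cellAverage_charExp, h1]
  rw [sum_cantorNodes_succ hD, unitFourier_mul hN, ← hη]
  simp only [Complex.real_smul, h2, ← Finset.mul_sum, ← Finset.sum_mul]
  generalize ∑ d ∈ Finset.range N, charExp η d = Y
  simp only [Finset.sum_mul, Finset.mul_sum (cantorNodes N D j)]
  rw [← Finset.sum_sub_distrib]
  refine Finset.sum_congr rfl fun a _ => ?_
  push_cast
  field_simp
  ring

/-- Dividing the deviation by `t ^ (j + 1)` leaves `(j + 1) s ^ (-j)`. Of the decay `1 / (1 + |η|)`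
at `η = ξ / N ^ (j + 1)` only the power `b` is kept: it costs `N ^ (b (j + 1))` and yields `(1 +
|ξ|) ^ (-b)`. -/
theorem norm_approxFourier_succ_sub_le {N s t : ℕ} {D : ℕ → ℕ → Finset ℕ} {K b : ℝ}
    (hD : IsDigitChoice N t D) (hs : 0 < s) (hst : t = s ^ 2) (hN : 1 ≤ N)
    (hb0 : 0 ≤ b) (hb1 : b ≤ 1) (hK0 : 0 ≤ K)
    (hK : ∀ j θ, ‖levelDeviation N t (cantorNodes N D j) (D j) θ‖
      ≤ K * (j + 1) * (t * (s : ℝ) ^ j)) (ξ : ℝ) (j : ℕ) :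
    ‖approxFourier N t D ξ (j + 1) - approxFourier N t D ξ j‖
      ≤ 2 * K * (N : ℝ) ^ b * (1 + |ξ|) ^ (-b) * ((j + 1) * ((N : ℝ) ^ b / s) ^ j) := by
  have ht : 0 < t := by rw [hst]; positivity
  have ht' : (0 : ℝ) < t := by exact_mod_cast ht
  have hs' : (0 : ℝ) < s := by exact_mod_cast hs
  have hN' : (1 : ℝ) ≤ N := by exact_mod_cast hN
  have hNj : (1 : ℝ) ≤ (N : ℝ) ^ (j + 1) := one_le_pow₀ hN'
  rw [approxFourier_succ_sub hD ht hN]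
  set η := ξ / (N : ℝ) ^ (j + 1) with hη
  have h1 : 1 + |ξ| ≤ (N : ℝ) ^ (j + 1) * (1 + |η|) := by
    rw [hη, abs_div, abs_of_pos (by positivity : (0 : ℝ) < (N : ℝ) ^ (j + 1)), mul_add,
      mul_div_cancel₀ _ (by positivity)]
    linarith
  have h2 : 1 / (1 + |η|) ≤ ((N : ℝ) ^ b * ((N : ℝ) ^ b) ^ j) * (1 + |ξ|) ^ (-b) := by
    have h3 : (1 + |ξ|) ^ b ≤ ((N : ℝ) ^ b * ((N : ℝ) ^ b) ^ j) * (1 + |η|) ^ b := by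
      refine (Real.rpow_le_rpow (by positivity) h1 hb0).trans_eq ?_
      rw [Real.mul_rpow (by positivity) (by positivity), ← pow_succ', ← Real.rpow_natCast,
        ← Real.rpow_mul (by positivity), mul_comm _ b, Real.rpow_mul (by positivity),
        Real.rpow_natCast]
    have h4 : (1 + |η|) ^ b ≤ 1 + |η| := by
      conv_rhs => rw [← Real.rpow_one (1 + |η|)]
      exact Real.rpow_le_rpow_of_exponent_le (by linarith [abs_nonneg η]) hb1
    rw [Real.rpow_neg (by positivity), ← div_eq_mul_inv, div_le_div_iff₀ (by positivity)
      (by positivity), one_mul]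
    exact h3.trans (by gcongr)
  rw [norm_smul, norm_mul, Real.norm_of_nonneg (by positivity)]
  calc _ ≤ ((t : ℝ) ^ (j + 1))⁻¹ * (2 / (1 + |η|) * (K * (j + 1) * (t * (s : ℝ) ^ j))) := by
        gcongr
        · exact norm_unitFourier_le η
        · exact hK j η
    _ = 2 * K * (j + 1) * ((t : ℝ) ^ j)⁻¹ * (s : ℝ) ^ j * (1 / (1 + |η|)) := by
        rw [pow_succ]
        field_simp
    _ ≤ 2 * K * (j + 1) * ((t : ℝ) ^ j)⁻¹ * (s : ℝ) ^ j *
        (((N : ℝ) ^ b * ((N : ℝ) ^ b) ^ j) * (1 + |ξ|) ^ (-b)) := by gcongr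
    _ = _ := by
        rw [hst, div_pow]
        push_cast
        rw [← pow_mul, mul_comm 2 j, pow_mul]
        field_simp

theorem exists_fourierOf_cantorMeasure_le {N s t : ℕ} {D : ℕ → ℕ → Finset ℕ} {α K : ℝ}
    (hD : IsDigitChoice N t D) (hs : 0 < s) (hst : t = s ^ 2) (hN : 1 < N)
    (hα0 : 0 < α) (hα1 : α < 1) (hNs : (N : ℝ) ^ (α / 2) = s)
    (hK : ∀ j θ, ‖levelDeviation N t (cantorNodes N D j) (D j) θ‖
      ≤ K * (j + 1) * (t * (s : ℝ) ^ j)) {β : ℝ} (hβ : β < α) :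
    ∃ C : ℝ, ∀ ξ : ℝ, ‖fourierOf (cantorMeasure N t D) (fun _ => 1) ξ‖
      ≤ C * (1 + |ξ|) ^ (-β / 2) := by
  have ht : 0 < t := by rw [hst]; positivity
  have ht' : (0 : ℝ) < t := by exact_mod_cast ht
  have hs' : (0 : ℝ) < s := by exact_mod_cast hs
  have hN' : (1 : ℝ) < N := by exact_mod_cast hN
  have hK0 : 0 ≤ K := by
    have := (norm_nonneg _).trans (hK 0 0)
    simp only [Nat.cast_zero, zero_add, mul_one, pow_zero] at this
    exact nonneg_of_mul_nonneg_left this ht'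
  -- Negative `β` is allowed, while the increment estimate needs `b ≥ 0`. The ratio `N ^ b / s` is
  -- below one because `b < α / 2`.
  set b := max β 0 / 2 with hb
  have hb0 : 0 ≤ b := div_nonneg (le_max_right _ _) (by norm_num)
  have hbα : b < α / 2 := by
    have : max β 0 < α := max_lt hβ hα0
    linarith
  have hb1 : b ≤ 1 := by linarith
  set ρ := (N : ℝ) ^ b / s with hρ
  have hρ0 : 0 ≤ ρ := by positivity
  have hρ1 : ρ < 1 := by
    rw [hρ, div_lt_one hs', ← hNs]
    exact Real.rpow_lt_rpow_of_exponent_lt hN' hbα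
  have hsum : Summable fun j : ℕ => ((j : ℝ) + 1) * ρ ^ j := by
    have h1 := summable_pow_mul_geometric_of_norm_lt_one 1 (r := ρ)
      (by rwa [Real.norm_of_nonneg hρ0])
    have h2 := summable_geometric_of_lt_one hρ0 hρ1
    refine (h1.add h2).congr fun j => ?_
    ring
  set S := ∑' j : ℕ, ((j : ℝ) + 1) * ρ ^ j with hS
  refine ⟨2 + 2 * K * (N : ℝ) ^ b * S, fun ξ => ?_⟩
  have hS0 : 0 ≤ S := tsum_nonneg fun j => by positivity
  have hξ : 1 ≤ 1 + |ξ| := by linarith [abs_nonneg ξ]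
  have h0 : ‖approxFourier N t D ξ 0‖ ≤ 2 * (1 + |ξ|) ^ (-b) := by
    have h1 : approxFourier N t D ξ 0 = unitFourier ξ := by
      simp [approxFourier, cantorNodes, cellAverage_charExp, charExp_zero_right]
    rw [h1]
    refine (norm_unitFourier_le ξ).trans ?_
    rw [div_eq_mul_inv, ← Real.rpow_neg_one]
    gcongr
  have hn : ∀ n : ℕ, ‖approxFourier N t D ξ n‖
      ≤ (2 + 2 * K * (N : ℝ) ^ b * S) * (1 + |ξ|) ^ (-b) := by
    intro n
    have h1 : approxFourier N t D ξ n = approxFourier N t D ξ 0 +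
        ∑ j ∈ Finset.range n, (approxFourier N t D ξ (j + 1) - approxFourier N t D ξ j) := by
      rw [Finset.sum_range_sub]
      ring
    rw [h1]
    refine (norm_add_le _ _).trans ?_
    have h2 := norm_sum_le_of_le (Finset.range n) fun j _ =>
      norm_approxFourier_succ_sub_le hD hs hst hN.le hb0 hb1 hK0 hK ξ j
    rw [← Finset.mul_sum] at h2
    have h3 := hsum.sum_le_tsum (Finset.range n) fun j _ => by positivity
    calc _ ≤ 2 * (1 + |ξ|) ^ (-b) + 2 * K * (N : ℝ) ^ b * (1 + |ξ|) ^ (-b) * S := by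
          refine add_le_add h0 (h2.trans ?_)
          gcongr
      _ = _ := by ring
  have hlim := tendsto_sum_cellAverage hD ht hN (continuous_charExp ξ) (C := 1)
    (fun x => (norm_charExp ξ x).le)
  rw [fourierOf_eq]
  simp only [mul_one]
  refine (le_of_tendsto hlim.norm (Eventually.of_forall hn)).trans ?_
  gcongr
  rw [hb]
  linarith [le_max_left β 0]

/-! ### Convolution powers and Gaussian energies -/

/-- The `r`-fold convolution power of a measure. -/
noncomputable def convPower (ρ : Measure ℝ) : ℕ → Measure ℝ
  | 0 => Measure.dirac 0
  | r + 1 => (convPower ρ r).conv ρ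

theorem isFiniteMeasure_convPower (ρ : Measure ℝ) [IsFiniteMeasure ρ] (r : ℕ) :
    IsFiniteMeasure (convPower ρ r) := by
  induction r with
  | zero => rw [convPower]; infer_instance
  | succ r ih => rw [convPower]; infer_instance

theorem integral_charExp_eq_charFun (ρ : Measure ℝ) (ξ : ℝ) :
    ∫ x, charExp ξ x ∂ρ = charFun ρ (-(2 * Real.pi * ξ)) := by
  rw [charFun_apply_real]
  refine integral_congr_ae (ae_of_all _ fun x => ?_)
  simp only [charExp]
  push_cast
  ring_nf

theorem charFun_convPower (ρ : Measure ℝ) [IsFiniteMeasure ρ] (r : ℕ) (x : ℝ) :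
    charFun (convPower ρ r) x = charFun ρ x ^ r := by
  induction r with
  | zero => simp [convPower, charFun_dirac]
  | succ r ih =>
    have := isFiniteMeasure_convPower ρ r
    rw [convPower, charFun_conv, ih, pow_succ]

theorem measureReal_convPower_univ (ρ : Measure ℝ) [IsFiniteMeasure ρ] (r : ℕ) :
    (convPower ρ r).real Set.univ = ρ.real Set.univ ^ r := by
  have h := charFun_convPower ρ r 0
  rw [charFun_zero, charFun_zero] at h
  exact_mod_cast h

theorem ae_conv_mem {μ ν : Measure ℝ} [SFinite μ] [SFinite ν] {A B C : Set ℝ}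
    (hC : MeasurableSet C) (hA : ∀ᵐ x ∂μ, x ∈ A) (hB : ∀ᵐ x ∂ν, x ∈ B)
    (h : ∀ x ∈ A, ∀ y ∈ B, x + y ∈ C) : ∀ᵐ z ∂μ.conv ν, z ∈ C := by
  rw [Measure.conv]
  refine (ae_map_iff (p := fun z => z ∈ C) (by fun_prop) hC).2 ?_
  filter_upwards [Measure.quasiMeasurePreserving_fst.ae hA,
    Measure.quasiMeasurePreserving_snd.ae hB] with z h1 h2
  exact h _ h1 _ h2

/-- Digits are added place by place without carrying, so `m + k` may exceed `N`. The resulting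
digits still form an interval, which keeps sumsets small. -/
theorem add_mem_cantorNodes_const {N m k l a b : ℕ}
    (ha : a ∈ cantorNodes N (fun _ _ => Finset.range (m + 1)) l)
    (hb : b ∈ cantorNodes N (fun _ _ => Finset.range (k + 1)) l) :
    a + b ∈ cantorNodes N (fun _ _ => Finset.range (m + k + 1)) l := by
  induction l generalizing a b with
  | zero => simp [cantorNodes] at ha hb ⊢; omega
  | succ l ih =>
    obtain ⟨a', ha', d, hd, rfl⟩ := mem_cantorNodes_succ.1 ha
    obtain ⟨b', hb', e, he, rfl⟩ := mem_cantorNodes_succ.1 hb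
    refine mem_cantorNodes_succ.2 ⟨_, ih ha' hb', d + e, ?_, by ring⟩
    rw [Finset.mem_range] at hd he ⊢
    omega

theorem zero_mem_cantorNodes_const (N k l : ℕ) :
    0 ∈ cantorNodes N (fun _ _ => Finset.range (k + 1)) l := by
  induction l with
  | zero => simp [cantorNodes]
  | succ l ih => exact mem_cantorNodes_succ.2 ⟨0, ih, 0, by simp, by simp⟩

/-- Each convolution adds one unit to the width of the cells; the Dirac mass at `r = 0` already sits
in `[0, 1)`, hence `r + 1`. -/
theorem ae_convPower_mem {ρ : Measure ℝ} [IsFiniteMeasure ρ] {N k l : ℕ} {R : ℝ}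
    (hρ : ∀ᵐ x ∂ρ, ∃ a ∈ cantorNodes N (fun _ _ => Finset.range (k + 1)) l,
      R * x ∈ Set.Ico (a : ℝ) (a + 1)) (r : ℕ) :
    ∀ᵐ x ∂convPower ρ r, ∃ a ∈ cantorNodes N (fun _ _ => Finset.range (r * k + 1)) l,
      R * x ∈ Set.Ico (a : ℝ) (a + (r + 1)) := by
  induction r with
  | zero =>
    rw [convPower]
    have hz := zero_mem_cantorNodes_const N (0 * k) l
    have : ∃ a ∈ cantorNodes N (fun _ _ => Finset.range (0 * k + 1)) l,
      R * (0 : ℝ) ∈ Set.Ico (a : ℝ) (a + ((0 : ℕ) + 1)) := ⟨0, hz, by simp⟩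
    rw [ae_dirac_eq]
    exact this
  | succ r ih =>
    have := isFiniteMeasure_convPower ρ r
    rw [convPower]
    refine ae_conv_mem (A := {x | _}) (B := {x | _}) (C := {x | _}) ?_ ih hρ ?_
    · have : {x : ℝ | ∃ a ∈ cantorNodes N (fun _ _ => Finset.range ((r + 1) * k + 1)) l,
          R * x ∈ Set.Ico (a : ℝ) (a + ((r + 1 : ℕ) + 1))}
          = ⋃ a ∈ cantorNodes N (fun _ _ => Finset.range ((r + 1) * k + 1)) l,
            (fun x : ℝ => R * x) ⁻¹' Set.Ico (a : ℝ) (a + ((r + 1 : ℕ) + 1)) := by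
        ext x
        simp only [Set.mem_ofPred_eq, Set.mem_iUnion, Set.mem_preimage, exists_prop]
      rw [this]
      exact Finset.measurableSet_biUnion _ fun a _ =>
        (measurable_const.mul measurable_id) measurableSet_Ico
    · rintro x ⟨a, ha, hx⟩ y ⟨b, hb, hy⟩
      refine ⟨a + b, ?_, ?_, ?_⟩
      · have := add_mem_cantorNodes_const ha hb
        rwa [← Nat.succ_mul] at this
      · push_cast
        linarith [hx.1, hy.1]
      · push_cast
        linarith [hx.2, hy.2]

theorem integral_charExp_mul_gaussian {R : ℝ} (hR : 0 < R) (w : ℝ) :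
    ∫ ξ : ℝ, charExp ξ w * (Real.exp (-(Real.pi / R ^ 2) * ξ ^ 2) : ℝ)
      = ((R * Real.exp (-Real.pi * (R * w) ^ 2) : ℝ) : ℂ) := by
  have hpi := Real.pi_pos
  have h := fourierIntegral_gaussian (b := ((Real.pi / R ^ 2 : ℝ) : ℂ))
    (by rw [Complex.ofReal_re]; positivity) (((-(2 * Real.pi * w) : ℝ) : ℂ))
  have h1 : ∀ ξ : ℝ, charExp ξ w * (Real.exp (-(Real.pi / R ^ 2) * ξ ^ 2) : ℝ)
      = Complex.exp (Complex.I * ((-(2 * Real.pi * w) : ℝ) : ℂ) * ξ)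
        * Complex.exp (-((Real.pi / R ^ 2 : ℝ) : ℂ) * (ξ : ℂ) ^ 2) := by
    intro ξ
    rw [charExp]
    push_cast
    ring_nf
  simp_rw [h1, h]
  have h2 : ((Real.pi : ℂ) / ((Real.pi / R ^ 2 : ℝ) : ℂ)) ^ (1 / 2 : ℂ) = R := by
    have h3 : (Real.pi : ℂ) / ((Real.pi / R ^ 2 : ℝ) : ℂ) = ((R ^ 2 : ℝ) : ℂ) := by
      rw [← Complex.ofReal_div]
      congr 1
      field_simp
    have h4 : (1 / 2 : ℂ) = ((1 / 2 : ℝ) : ℂ) := by push_cast; rfl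
    rw [h3, h4, ← Complex.ofReal_cpow (by positivity), ← Real.sqrt_eq_rpow, Real.sqrt_sq hR.le]
  rw [h2]
  push_cast
  congr 2
  have : (Real.pi : ℂ) ≠ 0 := by exact_mod_cast hpi.ne'
  have : (R : ℂ) ≠ 0 := by exact_mod_cast hR.ne'
  field_simp
  ring

theorem normSq_integral_charExp (ν : Measure ℝ) [IsFiniteMeasure ν] (ξ : ℝ) :
    ((‖∫ x, charExp ξ x ∂ν‖ ^ 2 : ℝ) : ℂ) = ∫ z : ℝ × ℝ, charExp ξ (z.1 - z.2) ∂ν.prod ν := by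
  have h1 : ∀ z : ℝ × ℝ, charExp ξ (z.1 - z.2)
      = charExp ξ z.1 * (starRingEnd ℂ) (charExp ξ z.2) := by
    intro z
    rw [sub_eq_add_neg, charExp_add]
    congr 1
    rw [charExp, charExp, ← Complex.exp_conj]
    congr 1
    rw [map_mul, Complex.conj_I, Complex.conj_ofReal]
    push_cast
    ring
  simp_rw [h1]
  rw [integral_prod_mul (fun x => charExp ξ x) (fun x => (starRingEnd ℂ) (charExp ξ x)),
    integral_conj, Complex.mul_conj, Complex.normSq_eq_norm_sq]

/-- Fubini turns the weighted `L²` energy of the transform into a double integral of a positive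
kernel concentrated at distance `1 / R`. -/
theorem integral_normSq_mul_gaussian (ν : Measure ℝ) [IsFiniteMeasure ν] {R : ℝ} (hR : 0 < R) :
    ∫ ξ : ℝ, ‖∫ x, charExp ξ x ∂ν‖ ^ 2 * Real.exp (-(Real.pi / R ^ 2) * ξ ^ 2)
      = ∫ z : ℝ × ℝ, R * Real.exp (-Real.pi * (R * (z.1 - z.2)) ^ 2) ∂ν.prod ν := by
  have hb : 0 < Real.pi / R ^ 2 := by have := Real.pi_pos; positivity
  have hint : Integrable (Function.uncurry fun (ξ : ℝ) (z : ℝ × ℝ) => charExp ξ (z.1 - z.2)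
      * (Real.exp (-(Real.pi / R ^ 2) * ξ ^ 2) : ℝ)) (volume.prod (ν.prod ν)) := by
    refine Integrable.mono' ((integrable_exp_neg_mul_sq hb).comp_fst (ν.prod ν)) ?_ ?_
    · refine Continuous.aestronglyMeasurable ?_
      unfold Function.uncurry charExp
      fun_prop
    · refine ae_of_all _ fun z => ?_
      rw [Function.uncurry, norm_mul, norm_charExp, one_mul, Complex.norm_real,
        Real.norm_of_nonneg (Real.exp_pos _).le]
  have h := integral_integral_swap hint
  have h1 : ∀ ξ : ℝ, ∫ z : ℝ × ℝ, charExp ξ (z.1 - z.2)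
      * (Real.exp (-(Real.pi / R ^ 2) * ξ ^ 2) : ℝ) ∂ν.prod ν
      = ((‖∫ x, charExp ξ x ∂ν‖ ^ 2 * Real.exp (-(Real.pi / R ^ 2) * ξ ^ 2) : ℝ) : ℂ) := by
    intro ξ
    rw [integral_mul_const, ← normSq_integral_charExp]
    push_cast
    rfl
  simp_rw [h1, integral_charExp_mul_gaussian hR] at h
  rw [integral_complex_ofReal, integral_complex_ofReal] at h
  exact_mod_cast h

/-- Cauchy–Schwarz over the cells of length `1 / R` bounds the squared mass by `C.card` times the
mass of pairs sharing a cell. For such pairs `R |z.1 - z.2| < 1`, so the kernel is at least `R * exp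
(-π)`. -/
theorem sq_measureReal_le_integral_gaussian (ν : Measure ℝ) [IsFiniteMeasure ν] {R : ℝ}
    (hR : 0 < R) {C : Finset ℤ} (hC : ∀ᵐ z ∂ν, ⌊R * z⌋ ∈ C) :
    R * Real.exp (-Real.pi) * ν.real Set.univ ^ 2
      ≤ C.card * ∫ ξ : ℝ, ‖∫ x, charExp ξ x ∂ν‖ ^ 2 * Real.exp (-(Real.pi / R ^ 2) * ξ ^ 2) := by
  rw [integral_normSq_mul_gaussian ν hR]
  set J : ℤ → Set ℝ := fun c => {z | ⌊R * z⌋ = c} with hJ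
  have hJm : ∀ c, MeasurableSet (J c) := fun c =>
    (Int.measurable_floor.comp (measurable_const.mul measurable_id)) (measurableSet_singleton c)
  have h1 : ν.real Set.univ ≤ ∑ c ∈ C, ν.real (J c) := by
    have : ν.real Set.univ = ν.real (⋃ c ∈ C, J c) := by
      refine measureReal_congr ?_
      filter_upwards [hC] with z hz
      refine propext ⟨fun _ => ?_, fun _ => trivial⟩
      exact Set.mem_iUnion₂.2 ⟨_, hz, rfl⟩
    rw [this]
    exact measureReal_biUnion_finset_le _ _
  have h2 : ν.real Set.univ ^ 2 ≤ C.card * ∑ c ∈ C, ν.real (J c) ^ 2 :=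
    (pow_le_pow_left₀ measureReal_nonneg h1 2).trans sq_sum_le_card_mul_sum_sq
  let k : ℤ → ℝ × ℝ → ℝ := fun c => ((J c) ×ˢ (J c)).indicator fun _ => 1
  have hk : ∀ c, ∫ z, k c z ∂ν.prod ν = ν.real (J c) ^ 2 := by
    intro c
    rw [integral_indicator ((hJm c).prod (hJm c)), setIntegral_const, smul_eq_mul, mul_one,
      measureReal_prod_prod, sq]
  have hki : ∀ c, Integrable (k c) (ν.prod ν) := fun c =>
    (integrable_const (1 : ℝ)).indicator ((hJm c).prod (hJm c))
  have hpt : ∀ z : ℝ × ℝ, R * Real.exp (-Real.pi) * ∑ c ∈ C, k c z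
      ≤ R * Real.exp (-Real.pi * (R * (z.1 - z.2)) ^ 2) := by
    intro z
    rw [mul_assoc]
    gcongr
    by_cases hz : ⌊R * z.1⌋ = ⌊R * z.2⌋
    · have h3 : ∑ c ∈ C, k c z ≤ 1 := by
        by_cases hzC : ⌊R * z.1⌋ ∈ C
        · rw [Finset.sum_eq_single_of_mem _ hzC]
          · exact Set.indicator_apply_le' (fun _ => le_rfl) (fun _ => zero_le_one)
          · intro c _ hc
            exact Set.indicator_of_notMem (fun h => hc h.1.symm) _
        · rw [Finset.sum_eq_zero]
          · exact zero_le_one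
          · intro c hc
            exact Set.indicator_of_notMem (fun h => hzC (by
              have : ⌊R * z.1⌋ = c := h.1
              rwa [this])) _
      have h4 : (R * (z.1 - z.2)) ^ 2 ≤ 1 := by
        have := Int.abs_sub_lt_one_of_floor_eq_floor hz
        rw [← mul_sub] at this
        rw [sq_le_one_iff_abs_le_one]
        exact this.le
      calc Real.exp (-Real.pi) * ∑ c ∈ C, k c z ≤ Real.exp (-Real.pi) * 1 := by gcongr
        _ ≤ _ := by
          rw [mul_one, Real.exp_le_exp]
          nlinarith [Real.pi_pos]
    · rw [Finset.sum_eq_zero]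
      · rw [mul_zero]
        exact (Real.exp_pos _).le
      · intro c _
        refine Set.indicator_of_notMem (fun h => hz ?_) _
        have h5 : ⌊R * z.1⌋ = c := h.1
        have h6 : ⌊R * z.2⌋ = c := h.2
        rw [h5, h6]
  have hint : Integrable (fun z : ℝ × ℝ => R * Real.exp (-Real.pi * (R * (z.1 - z.2)) ^ 2))
      (ν.prod ν) := by
    refine Integrable.mono' (integrable_const R) (Continuous.aestronglyMeasurable (by fun_prop))
      (ae_of_all _ fun z => ?_)
    rw [Real.norm_of_nonneg (by positivity)]
    refine mul_le_of_le_one_right hR.le (Real.exp_le_one_iff.2 ?_)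
    nlinarith [Real.pi_pos, sq_nonneg (R * (z.1 - z.2))]
  have h7 : R * Real.exp (-Real.pi) * ∑ c ∈ C, ν.real (J c) ^ 2
      ≤ ∫ z : ℝ × ℝ, R * Real.exp (-Real.pi * (R * (z.1 - z.2)) ^ 2) ∂ν.prod ν := by
    rw [← Finset.sum_congr rfl fun c _ => hk c, ← integral_finsetSum _ fun c _ => hki c,
      ← integral_const_mul]
    exact integral_mono ((integrable_finsetSum _ fun c _ => hki c).const_mul _) hint hpt
  calc _ ≤ R * Real.exp (-Real.pi) * (C.card * ∑ c ∈ C, ν.real (J c) ^ 2) := by gcongr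
    _ = C.card * (R * Real.exp (-Real.pi) * ∑ c ∈ C, ν.real (J c) ^ 2) := by ring
    _ ≤ _ := by gcongr

/-! ### Lower bounds for the restriction quotient -/

theorem norm_integral_charExp_le (ρ : Measure ℝ) [IsFiniteMeasure ρ] (ξ : ℝ) :
    ‖∫ x, charExp ξ x ∂ρ‖ ≤ ρ.real Set.univ := by
  have := norm_integral_le_of_norm_le_const (μ := ρ) (f := charExp ξ) (C := 1)
    (ae_of_all _ fun x => (norm_charExp ξ x).le)
  rwa [one_mul] at this

theorem continuous_integral_charExp (ρ : Measure ℝ) [IsFiniteMeasure ρ] :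
    Continuous fun ξ : ℝ => ∫ x, charExp ξ x ∂ρ := by
  refine continuous_of_dominated (bound := fun _ => 1)
    (fun ξ => (continuous_charExp ξ).aestronglyMeasurable)
    (fun ξ => ae_of_all _ fun x => (norm_charExp ξ x).le) (integrable_const _)
    (ae_of_all _ fun x => ?_)
  unfold charExp
  fun_prop

/-- The energy bound for `convPower ρ r` controls the `2r`-th moment from below. Since the transform
is at most the mass `M` and `p - 2r ≤ 0`, its `p`-th power dominates `M ^ (p - 2r)` times its
`2r`-th power; the Gaussian weight, being at most one, can be dropped. -/
theorem le_eLpNorm_integral_charExp (ρ : Measure ℝ) [IsFiniteMeasure ρ] {N k l r : ℕ} {p : ℝ}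
    (hN : 0 < N) (hp : 1 ≤ p) (hpr : p ≤ 2 * r) (hρ0 : 0 < ρ.real Set.univ)
    (hρ : ∀ᵐ x ∂ρ, ∃ a ∈ cantorNodes N (fun _ _ => Finset.range (k + 1)) l,
      (N : ℝ) ^ l * x ∈ Set.Ico (a : ℝ) (a + 1)) :
    ENNReal.ofReal ((((N : ℝ) / (r * k + 1)) ^ l * (Real.exp (-Real.pi) / (r + 1))) ^ (1 / p)
      * ρ.real Set.univ)
      ≤ eLpNorm (fun ξ => ∫ x, charExp ξ x ∂ρ) (ENNReal.ofReal p) volume := by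
  have hp0 : 0 < p := by linarith
  have hN' : (0 : ℝ) < (N : ℝ) ^ l := by positivity
  set W := cantorNodes N (fun _ _ => Finset.range (r * k + 1)) l with hW
  set M := ρ.real Set.univ with hM
  set g : ℝ → ℂ := fun ξ => ∫ x, charExp ξ x ∂ρ with hg
  have := isFiniteMeasure_convPower ρ r
  -- A half-open interval of length `r + 1` starting at an integer `a` has floors `a, …, a + r`.
  set C : Finset ℤ := (W ×ˢ Finset.range (r + 1)).image fun w => ((w.1 + w.2 : ℕ) : ℤ) with hC
  have hCcard : (C.card : ℝ) ≤ ((r : ℝ) * k + 1) ^ l * (r + 1) := by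
    have h1 : C.card ≤ (r * k + 1) ^ l * (r + 1) := by
      refine Finset.card_image_le.trans ?_
      rw [Finset.card_product, Finset.card_range]
      refine Nat.mul_le_mul_right _ ?_
      simpa using card_cantorNodes_const_le N (Finset.range (r * k + 1)) l
    exact_mod_cast h1
  have hfl : ∀ᵐ z ∂convPower ρ r, ⌊(N : ℝ) ^ l * z⌋ ∈ C := by
    filter_upwards [ae_convPower_mem hρ r] with z hz
    obtain ⟨a, ha, h1, h2⟩ := hz
    have h3 : (a : ℤ) ≤ ⌊(N : ℝ) ^ l * z⌋ := Int.le_floor.2 (by exact_mod_cast h1)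
    have h4 : ⌊(N : ℝ) ^ l * z⌋ < (a : ℤ) + (r + 1) :=
      Int.floor_lt.2 (by push_cast; exact h2)
    refine Finset.mem_image.2 ⟨(a, (⌊(N : ℝ) ^ l * z⌋ - a).toNat),
      Finset.mem_product.2 ⟨ha, Finset.mem_range.2 (by omega)⟩, ?_⟩
    push_cast
    omega
  have hE := sq_measureReal_le_integral_gaussian (convPower ρ r) hN' hfl
  set γ : ℝ → ℝ := fun ξ => Real.exp (-(Real.pi / ((N : ℝ) ^ l) ^ 2) * ξ ^ 2) with hγ
  have hγ1 : ∀ ξ, γ ξ ≤ 1 := fun ξ => Real.exp_le_one_iff.2 (by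
    have : 0 ≤ Real.pi / ((N : ℝ) ^ l) ^ 2 * ξ ^ 2 := by have := Real.pi_pos; positivity
    linarith)
  have hgM : ∀ ξ, ‖g ξ‖ ≤ M := norm_integral_charExp_le ρ
  have hgc : Continuous g := continuous_integral_charExp ρ
  have hpow : ∀ ξ, ‖∫ x, charExp ξ x ∂convPower ρ r‖ ^ 2 = ‖g ξ‖ ^ (2 * r) := by
    intro ξ
    rw [integral_charExp_eq_charFun, charFun_convPower, ← integral_charExp_eq_charFun, norm_pow,
      ← pow_mul, mul_comm]
  rw [measureReal_convPower_univ, ← pow_mul, mul_comm r 2] at hE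
  simp_rw [hpow] at hE
  set I := ∫ ξ : ℝ, ‖g ξ‖ ^ (2 * r) * γ ξ with hI
  have hI0 : 0 ≤ I := integral_nonneg fun ξ => mul_nonneg (by positivity) (Real.exp_pos _).le
  have hlow : ((N : ℝ) / (r * k + 1)) ^ l * (Real.exp (-Real.pi) / (r + 1)) * M ^ p
      ≤ M ^ (p - (2 * r : ℕ)) * I := by
    have h1 : (N : ℝ) ^ l * Real.exp (-Real.pi) * M ^ (2 * r)
        ≤ ((r : ℝ) * k + 1) ^ l * (r + 1) * I := hE.trans (by gcongr)
    have h2 : M ^ p = M ^ (p - (2 * r : ℕ)) * M ^ (2 * r) := by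
      rw [← Real.rpow_natCast, ← Real.rpow_add hρ0, sub_add_cancel]
    calc _ = M ^ (p - (2 * r : ℕ)) * ((N : ℝ) ^ l * Real.exp (-Real.pi) * M ^ (2 * r)
          / (((r : ℝ) * k + 1) ^ l * (r + 1))) := by
          rw [h2, div_pow]
          field_simp
      _ ≤ M ^ (p - (2 * r : ℕ)) * I := by
          gcongr
          rw [div_le_iff₀ (by positivity)]
          linarith
  have hpt : ∀ ξ, M ^ (p - (2 * r : ℕ)) * (‖g ξ‖ ^ (2 * r) * γ ξ) ≤ ‖g ξ‖ ^ p := by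
    intro ξ
    rcases (norm_nonneg (g ξ)).eq_or_lt with h0 | h0
    · rw [← h0, Real.zero_rpow hp0.ne', zero_pow, zero_mul, mul_zero]
      rintro h
      have : r = 0 := by omega
      rw [this] at hpr
      norm_num at hpr
      linarith
    · have h1 : M ^ (p - (2 * r : ℕ)) ≤ ‖g ξ‖ ^ (p - (2 * r : ℕ)) :=
        Real.rpow_le_rpow_of_nonpos h0 (hgM ξ) (by push_cast; linarith)
      calc _ ≤ ‖g ξ‖ ^ (p - (2 * r : ℕ)) * (‖g ξ‖ ^ (2 * r) * 1) := by
            gcongr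
            exact hγ1 ξ
        _ = ‖g ξ‖ ^ p := by
            rw [mul_one, ← Real.rpow_natCast, ← Real.rpow_add h0, sub_add_cancel]
  have hint : Integrable fun ξ : ℝ => M ^ (p - (2 * r : ℕ)) * (‖g ξ‖ ^ (2 * r) * γ ξ) := by
    have hb : 0 < Real.pi / ((N : ℝ) ^ l) ^ 2 := by have := Real.pi_pos; positivity
    refine Integrable.const_mul ?_ _
    refine Integrable.mono' ((integrable_exp_neg_mul_sq hb).const_mul (M ^ (2 * r)))
      (Continuous.aestronglyMeasurable (by fun_prop)) (ae_of_all _ fun ξ => ?_)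
    rw [Real.norm_of_nonneg (mul_nonneg (by positivity) (Real.exp_pos _).le)]
    gcongr
    exact hgM ξ
  have hlint : ENNReal.ofReal (((N : ℝ) / (r * k + 1)) ^ l * (Real.exp (-Real.pi) / (r + 1))
      * M ^ p) ≤ ∫⁻ ξ, ‖g ξ‖ₑ ^ p := by
    calc _ ≤ ENNReal.ofReal (∫ ξ : ℝ, M ^ (p - (2 * r : ℕ)) * (‖g ξ‖ ^ (2 * r) * γ ξ)) := by
          rw [integral_const_mul]
          exact ENNReal.ofReal_le_ofReal hlow
      _ = ∫⁻ ξ : ℝ, ENNReal.ofReal (M ^ (p - (2 * r : ℕ)) * (‖g ξ‖ ^ (2 * r) * γ ξ)) := by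
          refine ofReal_integral_eq_lintegral_ofReal hint (ae_of_all _ fun ξ => ?_)
          have : 0 ≤ γ ξ := (Real.exp_pos _).le
          positivity
      _ ≤ ∫⁻ ξ, ‖g ξ‖ₑ ^ p := by
          refine lintegral_mono fun ξ => ?_
          rw [← ofReal_norm, ENNReal.ofReal_rpow_of_nonneg (norm_nonneg _) hp0.le]
          exact ENNReal.ofReal_le_ofReal (hpt ξ)
  rw [eLpNorm_eq_lintegral_rpow_enorm_toReal (by simpa using hp0) ENNReal.ofReal_ne_top,
    ENNReal.toReal_ofReal hp0.le]
  refine le_trans (le_of_eq ?_) (ENNReal.rpow_le_rpow hlint (by positivity))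
  rw [ENNReal.ofReal_rpow_of_nonneg (by positivity) (by positivity),
    Real.mul_rpow (y := M ^ p) (by positivity) (by positivity), ← Real.rpow_mul hρ0.le,
    mul_one_div_cancel hp0.ne', Real.rpow_one]

theorem fourierOf_structuredFun (μ : Measure ℝ) (N : ℕ) (P : Finset ℕ) (l : ℕ) (ξ : ℝ) :
    fourierOf μ (structuredFun N P l) ξ = ∫ x, charExp ξ x ∂μ.restrict (structuredSet N P l) := by
  rw [fourierOf_eq, ← integral_indicator (measurableSet_structuredSet N P l)]
  refine integral_congr_ae (ae_of_all _ fun x => ?_)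
  by_cases hx : x ∈ structuredSet N P l <;> simp [structuredFun, hx]

theorem ae_restrict_structuredSet (μ : Measure ℝ) {N : ℕ} (hN : 0 < N) (P : Finset ℕ) (l : ℕ) :
    ∀ᵐ x ∂μ.restrict (structuredSet N P l), ∃ a ∈ cantorNodes N (fun _ _ => P) l,
      (N : ℝ) ^ l * x ∈ Set.Ico (a : ℝ) (a + 1) := by
  have hN' : (0 : ℝ) < (N : ℝ) ^ l := by positivity
  filter_upwards [ae_restrict_mem (measurableSet_structuredSet N P l)] with x hx
  obtain ⟨a, ha, h1, h2⟩ := Set.mem_iUnion₂.1 hx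
  rw [div_le_iff₀ hN'] at h1
  rw [lt_div_iff₀ hN'] at h2
  exact ⟨a, ha, by linarith, by linarith⟩

/-- Numerator and denominator scale like `M` and `M ^ (1 / q)`. As `1 - 1 / q ≥ 0`, a lower bound on
`M` suffices. -/
theorem le_restriction_quotient {N s t l r : ℕ} {D : ℕ → ℕ → Finset ℕ} {p q : ℝ}
    (hD : IsDigitChoice N t D) (hs : 1 < s) (hst : t = s ^ 2) (htN : t ≤ N)
    (hP : cantorNodes N (fun _ _ => Finset.range s) l ⊆ cantorNodes N D l)
    (hp : 1 ≤ p) (hpr : p ≤ 2 * r) (hq : 1 ≤ q) :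
    ENNReal.ofReal ((Real.exp (-Real.pi) / (r + 1)) ^ (1 / p) *
        (((N : ℝ) / (r * s)) ^ (1 / p) * (s : ℝ) ^ (-(1 - 1 / q))) ^ l)
      ≤ eLpNorm (fourierOf (cantorMeasure N t D) (structuredFun N (Finset.range s) l))
          (ENNReal.ofReal p) volume /
        eLpNorm (structuredFun N (Finset.range s) l) (ENNReal.ofReal q) (cantorMeasure N t D) := by
  have hq0 : 0 < q := by linarith
  have hp0 : 0 < p := by linarith
  have hr : 1 ≤ r := by
    by_contra h
    have : r = 0 := by omega
    rw [this] at hpr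
    norm_num at hpr
    linarith
  have hr' : (1 : ℝ) ≤ r := by exact_mod_cast hr
  have hs' : (0 : ℝ) < s := by positivity
  have hsN : s ≤ N := by nlinarith
  have hN : 0 < N := by omega
  have hN' : (0 : ℝ) < N := by exact_mod_cast hN
  set μ := cantorMeasure N t D with hμ
  set F := structuredSet N (Finset.range s) l with hF
  set ρ := μ.restrict F with hρ
  set M := ρ.real Set.univ with hM
  have hMF : μ F = ENNReal.ofReal M := by
    rw [hM, ofReal_measureReal, hρ, Measure.restrict_apply_univ]
  have hlow : ((s : ℝ) ^ l)⁻¹ ≤ M := by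
    have h1 := le_cantorMeasure_structuredSet hD (by rw [hst]; nlinarith) hN (Finset.range s) l hP
    rw [card_cantorNodes (t := s) ⟨fun _ _ => Finset.range_subset_range.2 hsN,
      fun _ _ => Finset.card_range s⟩ (by omega), ← hμ, ← hF, hMF] at h1
    have h2 : ((s ^ l : ℕ) : ℝ≥0∞) * ((t : ℝ≥0∞) ^ l)⁻¹ = ENNReal.ofReal (((s : ℝ) ^ l)⁻¹) := by
      have ht' : (0 : ℝ) < (t : ℝ) ^ l := by rw [hst]; positivity
      rw [← ENNReal.ofReal_natCast, ← ENNReal.ofReal_natCast, ← ENNReal.ofReal_pow (by positivity),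
        ← ENNReal.ofReal_inv_of_pos ht', ← ENNReal.ofReal_mul (by positivity)]
      congr 1
      rw [hst]
      push_cast
      rw [← pow_mul, mul_comm 2 l, pow_mul]
      field_simp
    rw [h2] at h1
    exact (ENNReal.ofReal_le_ofReal_iff measureReal_nonneg).1 h1
  have hM0 : 0 < M := lt_of_lt_of_le (by positivity) hlow
  have hden : eLpNorm (structuredFun N (Finset.range s) l) (ENNReal.ofReal q) μ
      = ENNReal.ofReal (M ^ (1 / q)) := by
    rw [structuredFun, eLpNorm_indicator_const (measurableSet_structuredSet _ _ _)
      (by simpa using hq0) ENNReal.ofReal_ne_top, ENNReal.toReal_ofReal hq0.le, ← hF, hMF,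
      ENNReal.ofReal_rpow_of_pos hM0]
    simp
  have hnum := le_eLpNorm_integral_charExp ρ (k := s - 1) (l := l) (r := r) hN hp hpr hM0 (by
    rw [Nat.sub_add_cancel hs.le]
    exact ae_restrict_structuredSet μ hN _ l)
  have hfun : fourierOf μ (structuredFun N (Finset.range s) l)
      = fun ξ => ∫ x, charExp ξ x ∂ρ := funext fun ξ => fourierOf_structuredFun μ N _ l ξ
  rw [hfun, hden]
  refine le_trans ?_ (ENNReal.div_le_div_right hnum _)
  rw [← ENNReal.ofReal_div_of_pos (by positivity)]
  refine ENNReal.ofReal_le_ofReal ?_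
  have h1 : M ^ (1 - 1 / q) = M / M ^ (1 / q) := by rw [Real.rpow_sub hM0, Real.rpow_one]
  have hq1 : 0 ≤ 1 - 1 / q := by
    rw [sub_nonneg, div_le_one hq0]
    exact hq
  have h2 : ((s : ℝ) ^ (-(1 - 1 / q))) ^ l ≤ M ^ (1 - 1 / q) := by
    refine le_trans (le_of_eq ?_) (Real.rpow_le_rpow (by positivity) hlow hq1)
    rw [Real.rpow_neg hs'.le, inv_pow, Real.inv_rpow (by positivity), ← Real.rpow_natCast,
      ← Real.rpow_mul hs'.le, mul_comm, Real.rpow_mul hs'.le, Real.rpow_natCast]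
  -- Uses `r (s - 1) + 1 ≤ r s`, valid since `r ≥ 1`.
  have h3 : ((N : ℝ) / (r * s)) ^ l ≤ ((N : ℝ) / (r * ((s - 1 : ℕ) : ℝ) + 1)) ^ l := by
    have h4 : (1 : ℝ) ≤ s := by exact_mod_cast hs.le
    gcongr
    rw [Nat.cast_sub hs.le]
    push_cast
    linarith
  calc _ = (((N : ℝ) / (r * s)) ^ l *
        (Real.exp (-Real.pi) / (r + 1))) ^ (1 / p) * ((s : ℝ) ^ (-(1 - 1 / q))) ^ l := by
        rw [mul_pow, Real.mul_rpow (by positivity) (by positivity)]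
        have : (((N : ℝ) / (r * s)) ^ (1 / p)) ^ l = (((N : ℝ) / (r * s)) ^ l) ^ (1 / p) := by
          rw [← Real.rpow_natCast, ← Real.rpow_natCast, ← Real.rpow_mul (by positivity),
            ← Real.rpow_mul (by positivity), mul_comm (1 / p)]
        rw [this]
        ring
    _ ≤ (((N : ℝ) / (r * ((s - 1 : ℕ) : ℝ) + 1)) ^ l *
        (Real.exp (-Real.pi) / (r + 1))) ^ (1 / p) * M ^ (1 - 1 / q) := by
        gcongr
    _ = _ := by rw [h1, mul_div_assoc]

/-! ### Choice of the parameters -/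

/-- For a large power of the base, the restriction quotients grow geometrically. -/
theorem exists_pow_one_lt_growth {α p q N₀ t₀ : ℝ} (r : ℕ) (hr : 1 ≤ r) (hN₀ : 1 < N₀)
    (ht₀ : N₀ ^ α = t₀) (hp : 1 ≤ p) (hq : 1 ≤ q)
    (hpq : p * (α * (q - 1)) < q * (2 - α)) :
    ∃ n : ℕ, 1 ≤ n ∧
      1 < (N₀ ^ (2 * n) / (r * t₀ ^ n)) ^ (1 / p) * (t₀ ^ n) ^ (-(1 - 1 / q)) := by
  have hp0 : 0 < p := by linarith
  have hq0 : 0 < q := by linarith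
  have hN0 : 0 < N₀ := by linarith
  have hr' : (1 : ℝ) ≤ r := by exact_mod_cast hr
  -- With `X = N₀ ^ n` the growth factor equals `(X ^ κ / r) ^ (1 / p)`. Positivity of `κ` is the
  -- hypothesis divided by `q`, and a large `n` then beats the fixed `r`.
  set κ := 2 - α - α * (p * (1 - 1 / q)) with hκ
  have hκ0 : 0 < κ := by
    have h : q * κ = q * (2 - α) - p * (α * (q - 1)) := by
      rw [hκ]
      field_simp
    have : 0 < q * κ := by linarith
    exact pos_of_mul_pos_right this hq0.le
  obtain ⟨n, hn, hn1⟩ := ((tendsto_pow_atTop_atTop_of_one_lt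
    (Real.one_lt_rpow hN₀ hκ0)).eventually_gt_atTop (r : ℝ)).and (eventually_ge_atTop 1) |>.exists
  refine ⟨n, hn1, ?_⟩
  set X := N₀ ^ n with hX
  have hX0 : 0 < X := by positivity
  have h1 : t₀ ^ n = X ^ α := by
    rw [hX, ← ht₀, ← Real.rpow_natCast, ← Real.rpow_natCast, ← Real.rpow_mul hN0.le,
      ← Real.rpow_mul hN0.le, mul_comm]
  have h2 : N₀ ^ (2 * n) = X ^ (2 : ℝ) := by
    rw [hX, mul_comm, pow_mul]
    norm_cast
  have h3 : (N₀ ^ κ) ^ n = X ^ κ := by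
    rw [hX, ← Real.rpow_natCast, ← Real.rpow_natCast, ← Real.rpow_mul hN0.le,
      ← Real.rpow_mul hN0.le, mul_comm]
  have h4 : (X ^ (2 : ℝ) / (r * X ^ α)) ^ (1 / p) * (X ^ α) ^ (-(1 - 1 / q))
      = (X ^ κ / r) ^ (1 / p) := by
    have h5 : (X ^ α) ^ (-(1 - 1 / q)) = (X ^ (-(α * (p * (1 - 1 / q))))) ^ (1 / p) := by
      rw [← Real.rpow_mul hX0.le, ← Real.rpow_mul hX0.le]
      congr 1
      field_simp
    rw [h5, ← Real.mul_rpow (by positivity) (by positivity)]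
    congr 1
    rw [hκ, Real.rpow_sub hX0, Real.rpow_sub hX0, Real.rpow_neg hX0.le]
    field_simp
  rw [h1, h2, h4]
  refine Real.one_lt_rpow ?_ (by positivity)
  rw [one_lt_div (by linarith), ← h3]
  exact hn

theorem rpow_eq_of_eq_log_div_log {α : ℝ} {t₀ N₀ : ℕ} (ht₀ : 1 ≤ t₀) (hN₀ : 2 ≤ N₀)
    (hα : α = Real.log (t₀ : ℝ) / Real.log (N₀ : ℝ)) : (N₀ : ℝ) ^ α = t₀ := by
  have h1 : (1 : ℝ) < N₀ := by exact_mod_cast hN₀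
  have h2 : (0 : ℝ) < t₀ := by exact_mod_cast ht₀
  rw [Real.rpow_def_of_pos (by linarith), hα, mul_div_cancel₀ _ (Real.log_pos h1).ne',
    Real.exp_log h2]

theorem tendsto_restriction_quotient {N s t r : ℕ} {D : ℕ → ℕ → Finset ℕ} {p q : ℝ}
    (hD : IsDigitChoice N t D) (hs : 1 < s) (hst : t = s ^ 2) (htN : t ≤ N)
    (hP : ∀ l, cantorNodes N (fun _ _ => Finset.range s) l ⊆ cantorNodes N D l)
    (hp : 1 ≤ p) (hpr : p ≤ 2 * r) (hq : 1 ≤ q)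
    (hgrowth : 1 < ((N : ℝ) / (r * s)) ^ (1 / p) * (s : ℝ) ^ (-(1 - 1 / q))) :
    Tendsto (fun l : ℕ =>
      eLpNorm (fourierOf (cantorMeasure N t D) (structuredFun N (Finset.range s) l))
          (ENNReal.ofReal p) volume /
        eLpNorm (structuredFun N (Finset.range s) l) (ENNReal.ofReal q) (cantorMeasure N t D))
      atTop (𝓝 ⊤) := by
  refine tendsto_nhds_top_mono ?_
    (Eventually.of_forall fun l => le_restriction_quotient hD hs hst htN (hP l) hp hpr hq)
  refine ENNReal.tendsto_ofReal_atTop.comp ?_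
  exact (tendsto_pow_atTop_atTop_of_one_lt hgrowth).const_mul_atTop (by positivity)

theorem theorem3 (α : ℝ) (hα0 : 0 < α) (hα1 : α < 1)
    (t₀ N₀ : ℕ) (ht₀ : 1 ≤ t₀) (hN₀ : 2 ≤ N₀)
    (hα : α = Real.log (t₀ : ℝ) / Real.log (N₀ : ℝ))
    (p q : ℝ) (hp : 1 ≤ p) (hq : 1 ≤ q)
    (hpq : p * (α * (q - 1)) < q * (2 - α)) :
    ∃ (n₀ N t : ℕ) (D : ℕ → ℕ → Finset ℕ) (x d : ℕ) (P : Finset ℕ) (μ : Measure ℝ),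
      -- the parameters of the construction
      1 ≤ n₀ ∧ N = N₀ ^ (2 * n₀) ∧ t = t₀ ^ (2 * n₀) ∧
      -- the Cantor iteration, containing the structured one
      IsDigitChoice N t D ∧
      1 ≤ d ∧ P = arithProg x d (t₀ ^ n₀) ∧ P ⊆ Finset.range N ∧
      (∀ j : ℕ, cantorNodes N (fun _ _ => P) j ⊆ cantorNodes N D j) ∧
      -- the measure is the natural measure on the Cantor set
      IsProbabilityMeasure μ ∧
      IsWeakLimit (cantorApprox N t D) μ ∧
      μ (Set.Icc (0 : ℝ) 1)ᶜ = 0 ∧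
      μ (cantorLimitSet N D)ᶜ = 0 ∧
      dimH (cantorLimitSet N D) = ENNReal.ofReal α ∧
      -- the ball condition
      (∃ C₁ : ℝ, ∀ y r : ℝ, 0 < r → μ (Metric.closedBall y r) ≤ ENNReal.ofReal (C₁ * r ^ α)) ∧
      -- the Fourier decay
      (∀ β : ℝ, β < α → ∃ C₂ : ℝ, ∀ ξ : ℝ,
        ‖fourierOf μ (fun _ => 1) ξ‖ ≤ C₂ * (1 + |ξ|) ^ (-β / 2)) ∧
      -- failure of the restriction estimate
      Tendsto (fun l : ℕ =>
          eLpNorm (fourierOf μ (structuredFun N P l)) (ENNReal.ofReal p) volume /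
            eLpNorm (structuredFun N P l) (ENNReal.ofReal q) μ)
        atTop (𝓝 ⊤) := by
  have hN₀' : (1 : ℝ) < N₀ := by exact_mod_cast hN₀
  have ht₀α := rpow_eq_of_eq_log_div_log ht₀ hN₀ hα
  have ht₀1 : 1 < t₀ := by
    have h : (1 : ℝ) < t₀ := ht₀α ▸ Real.one_lt_rpow hN₀' hα0
    exact_mod_cast h
  have ht₀N₀ : t₀ < N₀ := by
    have h : (t₀ : ℝ) < N₀ := by
      rw [← ht₀α]
      conv_rhs => rw [← Real.rpow_one (N₀ : ℝ)]
      exact Real.rpow_lt_rpow_of_exponent_lt hN₀' hα1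
    exact_mod_cast h
  have hr : 1 ≤ ⌈p⌉₊ := Nat.one_le_ceil_iff.2 (by linarith)
  have hpr : p ≤ 2 * (⌈p⌉₊ : ℕ) := by
    have := Nat.le_ceil p
    linarith
  -- The number of convolution factors `⌈p⌉₊` is fixed before `n`, so its loss is absorbed by
  -- enlarging the base.
  obtain ⟨n, hn, hgrowth⟩ := exists_pow_one_lt_growth ⌈p⌉₊ hr hN₀' ht₀α hp hq hpq
  set s := t₀ ^ n with hs
  set N := N₀ ^ (2 * n) with hN
  set t := t₀ ^ (2 * n) with ht
  have hs1 : 1 < s := Nat.one_lt_pow (by omega) ht₀1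
  have hst : t = s ^ 2 := by rw [ht, hs, ← pow_mul, mul_comm]
  have ht0 : 0 < t := by positivity
  have htN : t ≤ N := Nat.pow_le_pow_left ht₀N₀.le _
  have hN1 : 1 < N := Nat.one_lt_pow (by omega) hN₀
  have hNs : (N : ℝ) ^ (α / 2) = s := by
    rw [hN, hs]
    push_cast
    rw [← ht₀α, ← Real.rpow_natCast, ← Real.rpow_natCast, ← Real.rpow_mul (by positivity),
      ← Real.rpow_mul (by positivity)]
    congr 1
    push_cast
    ring
  have hNt : (N : ℝ) ^ α = t := by
    rw [hst]
    push_cast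
    rw [← hNs, ← Real.rpow_natCast, ← Real.rpow_mul (by positivity)]
    congr 1
    push_cast
    ring
  obtain ⟨D, K, hD, hPD, hK⟩ := exists_digitChoice (N := N) (by omega : 0 < s) hst htN
  refine ⟨n, N, t, D, 0, 1, Finset.range s, cantorMeasure N t D, hn, hN, ht, hD, le_rfl, ?_,
    Finset.range_subset_range.2 ?_, hPD, inferInstance, isWeakLimit_cantorMeasure hD ht0 hN1,
    measure_mono_null (Set.compl_subset_compl.2 (cantorLimitSet_subset_Icc N D))
      (cantorMeasure_compl_cantorLimitSet hD ht0 (by omega)),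
    cantorMeasure_compl_cantorLimitSet hD ht0 (by omega),
    dimH_cantorLimitSet hD ht0 hN1 hα0 hNt,
    ⟨4 * t, cantorMeasure_closedBall_le_rpow hD ht0 hN1 hα0.le hNt⟩,
    fun β hβ => exists_fourierOf_cantorMeasure_le hD (by omega) hst hN1 hα0 hα1 hNs hK hβ,
    tendsto_restriction_quotient hD hs1 hst htN hPD hp hpr hq ?_⟩
  · simp [arithProg, hs]
  · nlinarith
  · rw [hN, hs]
    push_cast
    exact hgrowth
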